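/- **Conventions.** A 2-crossed module $\mathcal A=(L\xrightarrow{\delta}E\xrightarrow{\partial}G,\triangleright,\{,\})$ consists of groups and group maps with $\partial\delta=1$, left actions $\triangleright$ of $G$ on $E$ and $L$ by automorphisms, for which $\delta$ is equivariant and $\partial(g\triangleright e)=g\,\partial(e)\,g^{-1}$, and a $G$-equivariant map $\{,\}\colon E\times E\to L$ (the Peiffer lifting) such that $\delta\{e,f\}=efe^{-1}\,(\partial(e)\triangleright f^{-1})$, $\{\delta l,\delta k\}=lkl^{-1}k^{-1}$, $\{\delta l,e\}\{e,\delta l\}=l\,(\partial(e)\triangleright l^{-1})$, $\{ef,g\}=\{e,fgf^{-1}\}\,\partial(e)\triangleright\{f,g\}$ and $\{e,fg\}=\{e,f\}\,(\partial(e)\triangleright f)\triangleright'\{e,g\}$, where $e\triangleright' l:=l\{\delta(l)^{-1},e\}$ (an action of $E$ on $L$ by automorphisms). Morphisms $(\mu,\psi,\phi)$ are triples of group maps preserving all the structure. Semidirect products have the product $(g,n)(g',n')=(gg',(g'^{-1}\triangleright n)\,n')$. *Homotopies.* Let $f=(\mu,\psi,\phi)$ and $f'=(\mu',\psi',\phi')$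 be morphisms from $(L\to E\to F)$ to $\mathcal A'=(L'\to E'\to G')$. A homotopy $f\xrightarrow{(f,s,t)}f'$ consists of maps $s\colon F\to E'$ and $t\colon E\to L'$ with $$s(gh)=(\phi(h)^{-1}\triangleright s(g))\,s(h),$$ $$t(ab)=\big(\psi(b)\,s(\partial b)\big)^{-1}\triangleright'\Big(\big\{\psi(b),\phi(\partial b)^{-1}\triangleright s(\partial a)^{-1}\big\}\,t(a)\Big)\;t(b),$$ $$t(g\triangleright a)=\phi(g)\triangleright\Big(\big(s(g)s(\partial a)^{-1}\big)\triangleright'\{\psi(a)^{-1},s(g)^{-1}\}^{-1}\Big)\;\phi(g)\triangleright\{s(g),s(\partial a)^{-1}\psi(a)^{-1}\}\;\big(\phi(g)\,\partial(s(g))\big)\triangleright t(a)$$ (a quadratic $f$-derivation) such that $\mu'(l)=\mu(l)\,t(\delta l)$, $\psi'(a)=\psi(a)\,s(\partial a)\,\delta(t(a))$ and $\phi'(g)=\phi(g)\,\partial(s(g))$. A $\phi$-derivation is a map $s$ satisfying the first of these identities. *Concatenation.* Let $F$ be free with a chosen basis $B$ and let $f\xrightarrow{(f,s,t)}f'\xrightarrow{(f',s',t')}f''$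 be homotopies. Let $s\otimes s'$ be the unique $\phi$-derivation with $(s\otimes s')(b)=s(b)s'(b)$ for $b\in B$. Let $\omega^{(s,s')}\colon F\to L'$ be the last component of the unique group map $F\to(G'\ltimes_\triangleright E')\ltimes_\bullet(E'\ltimes_{\triangleright'}L')$ with $b\mapsto((\phi(b),s(b)),(s'(b),1))$ for $b\in B$, where $(g,x)\bullet(e,k)=\big(g\triangleright(xex^{-1}),\,g\triangleright(\{x,e^{-1}\}\,\partial(x)\triangleright k)\big)$. Put $(t\otimes t')(e)=\omega^{(s,s')}(\partial e)\;\,s'(\partial e)^{-1}\triangleright' t(e)\;\,t'(e)$. The concatenation is $(f,s\otimes s',t\otimes t')$. Also let $\bar s$ be the unique $\phi'$-derivation with $\bar s(b)=s(b)^{-1}$ for $b\in B$, and put $\bar t(e)=\omega^{(s,\bar s)}(\partial e)^{-1}\;s(\partial e)\triangleright' t(e)^{-1}$. *Lax homotopies.* For a group $G$ let $\mathcal F(G)$ be the free group on the underlying set of $G$, with basis $\{[g]:g\in G\}$ and projection $p\colon\mathcal F(G)\to G$, $[g]\mapsto g$. For $\mathcal A=(L\to E\to G)$ put $Q^1(\mathcal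 A)=\big(L\to\{(e,u)\in E\times\mathcal F(G):\partial e=p(u)\}\to\mathcal F(G)\big)$, with boundary maps $k\mapsto(\delta k,1)$ and $(e,u)\mapsto u$, actions $u\triangleright(e,u')=(p(u)\triangleright e,uu'u^{-1})$ and $u\triangleright k=p(u)\triangleright k$, and lifting $\{(e,u),(e',u')\}=\{e,e'\}$. Let $\mathrm{proj}\colon Q^1(\mathcal A)\to\mathcal A$ be the projection, given by $\mathrm{id}_L$, $(e,u)\mapsto e$ and $p$. A lax homotopy from $f$ to $f'$, where $f,f'\colon\mathcal A\to\mathcal A'$, is a homotopy $(s,t)$ from $f\circ\mathrm{proj}$ to $f'\circ\mathrm{proj}$. It is written $(f,\hat s,\hat t,\Pi)$, where $\hat s(g)=s([g])$, $\hat t(e)=t(e,[\partial e])$ and $\Pi(g,h)=t(1,[gh]^{-1}[g][h])$. Lax homotopies are concatenated as homotopies of maps out of $Q^1(\mathcal A)$, with the basis $\{[g]\}$. For maps $s,s'\colon G\to E'$ and group maps $\phi,\phi'\colon G\to G'$ put $$\Theta^{(s,s')}(x,y,z)=s'(z)^{-1}\triangleright'\{s(z)^{-1},\phi(z)^{-1}\triangleright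 s'(y)^{-1}\}\;\cdot\;\big(\phi'(z)^{-1}\triangleright s'(y)\;s'(z)\big)^{-1}\triangleright'\Big(\big\{(\phi(z)^{-1}\triangleright s(y)\;s(z))^{-1},\,(\phi(yz)^{-1}\phi(x))\triangleright(s(x)s'(x)s(x)^{-1})\big\}\;\,(\phi'(yz)^{-1}\phi(x))\triangleright\{s(x),s'(x)\}\Big).$$ **Theorem.** Let $\mathcal A=(L\to E\to G)$ and $\mathcal A'=(L'\to E'\to G')$ be 2-crossed modules. 1. Let $f=(\mu,\psi,\phi)\xrightarrow{(f,\hat s,\hat t,\Pi)}f'=(\mu',\psi',\phi')\xrightarrow{(f',\hat s',\hat t',\Pi')}f''$ be lax homotopies of maps $\mathcal A\to\mathcal A'$. Their concatenation is a lax homotopy from $f$ to $f''$, and it is the unique lax homotopy from $f$ to $f''$ with components $$g\mapsto\hat s(g)\,\hat s'(g),\qquad e\mapsto\big(\hat s'(\partial e)^{-1}\triangleright'\hat t(e)\big)\,\hat t'(e),\qquad (g,h)\mapsto\Theta^{(\hat s,\hat s')}(gh,g,h)\,\Pi'(g,h)\,\Pi(g,h),$$ where $\Theta$ is formed with $\phi$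 and $\phi'$. 2. Let $f\xrightarrow{(f,\hat s,\hat t,\Pi)}f'$ be a lax homotopy, given by $(s,t)$. Then $(\bar s,\bar t)$ is a lax homotopy from $f'$ to $f$. It is a two-sided inverse of $(s,t)$ for concatenation: both concatenations are trivial, that is, have both maps constant with value $1$. It is the unique lax homotopy from $f'$ to $f$ with components $$g\mapsto\hat s(g)^{-1},\qquad e\mapsto\hat s(\partial e)\triangleright'\hat t(e)^{-1},\qquad (g,h)\mapsto\Theta^{(\hat s,\hat s^{-1})}(gh,g,h)^{-1}\,\Pi(g,h)^{-1},$$ where $\hat s^{-1}$ denotes $g\mapsto\hat s(g)^{-1}$ and $\Theta$ is formed with $\phi$ and $\phi'$. -/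

import Mathlib

/-! ### Semidirect products in the convention `(g, n)(g', n') = (g g', (g'⁻¹ ▷ n) n')` -/

/-- The underlying set of the semidirect product `G ⋉ N` for a left action `φ` of `G` on `N`
by automorphisms. -/
@[ext]
structure SDP {G N : Type*} [Group G] [Group N] (φ : G →* MulAut N) where
  /-- the component in `G` -/
  fst : G
  /-- the component in `N` -/
  snd : N

namespace SDP

variable {G N : Type*} [Group G] [Group N] {φ : G →* MulAut N}

instance : Mul (SDP φ) := ⟨fun u v => ⟨u.fst * v.fst, φ v.fst⁻¹ u.snd * v.snd⟩⟩
instance : One (SDP φ) := ⟨⟨1, 1⟩⟩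
instance : Inv (SDP φ) := ⟨fun u => ⟨u.fst⁻¹, φ u.fst u.snd⁻¹⟩⟩

@[simp] theorem mul_fst (u v : SDP φ) : (u * v).fst = u.fst * v.fst := rfl
@[simp] theorem mul_snd (u v : SDP φ) : (u * v).snd = φ v.fst⁻¹ u.snd * v.snd := rfl
@[simp] theorem one_fst : (1 : SDP φ).fst = 1 := rfl
@[simp] theorem one_snd : (1 : SDP φ).snd = 1 := rfl
@[simp] theorem inv_fst (u : SDP φ) : (u⁻¹).fst = u.fst⁻¹ := rfl
@[simp] theorem inv_snd (u : SDP φ) : (u⁻¹).snd = φ u.fst u.snd⁻¹ := rfl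

instance : Group (SDP φ) := Group.ofLeftAxioms
  (by
    intro a b c
    ext
    · simp [mul_assoc]
    · simp only [mul_fst, mul_snd, mul_inv_rev, map_mul, MulAut.mul_apply, mul_assoc])
  (by intro a; ext <;> simp)
  (by
    intro a
    ext
    · simp
    · simp only [mul_snd, inv_snd, map_inv, MulAut.inv_apply_self, one_snd, inv_mul_cancel])

end SDP

/-! ### 2-crossed modules -/

/-- A 2-crossed module of groups `L → E → G`. The left actions of `G` on `E` and on `L` by
automorphisms are `actE` and `actL`, and `lift e f` is the Peiffer lifting `{e, f}`. -/
structure TwoCrossedModule (L E G : Type*) [Group L] [Group E] [Group G] where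
  /-- the boundary map `δ : L → E` -/
  bdL : L →* E
  /-- the boundary map `∂ : E → G` -/
  bdE : E →* G
  /-- the action of `G` on `E` -/
  actE : G →* MulAut E
  /-- the action of `G` on `L` -/
  actL : G →* MulAut L
  /-- the Peiffer lifting -/
  lift : E → E → L
  bdE_bdL : ∀ l, bdE (bdL l) = 1
  bdE_act : ∀ g e, bdE (actE g e) = g * bdE e * g⁻¹
  bdL_act : ∀ g l, bdL (actL g l) = actE g (bdL l)
  act_lift : ∀ g e f, actL g (lift e f) = lift (actE g e) (actE g f)
  bdL_lift : ∀ e f, bdL (lift e f) = (e * f * e⁻¹) * actE (bdE e) f⁻¹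
  lift_bdL_bdL : ∀ l k, lift (bdL l) (bdL k) = l * k * l⁻¹ * k⁻¹
  lift_bdL_mul : ∀ l e, lift (bdL l) e * lift e (bdL l) = l * actL (bdE e) l⁻¹
  lift_mul_left : ∀ e f g,
    lift (e * f) g = lift e (f * g * f⁻¹) * actL (bdE e) (lift f g)
  /-- `{e, fg} = {e, f} ((∂ e ▷ f) ▷' {e, g})`, where `x ▷' l = l {δ(l)⁻¹, x}` -/
  lift_mul_right : ∀ e f g, lift e (f * g) =
    lift e f * (lift e g * lift (bdL (lift e g))⁻¹ (actE (bdE e) f))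

namespace TwoCrossedModule

section Basic

variable {L E G : Type*} [Group L] [Group E] [Group G] (A : TwoCrossedModule L E G)

/-- The secondary action `e ▷' l = l {δ(l)⁻¹, e}` of `E` on `L`, as a function. -/
def sec (e : E) (l : L) : L := l * A.lift (A.bdL l)⁻¹ e

theorem lift_mul_right' (e f g : E) :
    A.lift e (f * g) = A.lift e f * A.sec (A.actE (A.bdE e) f) (A.lift e g) :=
  A.lift_mul_right e f g

theorem lift_one_left (e : E) : A.lift 1 e = 1 := by
  have h := A.lift_mul_left 1 1 e
  simpa using h

theorem lift_one_right (e : E) : A.lift e 1 = 1 := by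
  have h := A.lift_mul_right e 1 1
  have h2 : A.bdL (A.lift e 1) = 1 := by simp [A.bdL_lift]
  rw [h2] at h
  simpa [lift_one_left] using h

theorem sec_one (l : L) : A.sec 1 l = l := by simp [sec, lift_one_right]

theorem bdL_sec (e : E) (l : L) : A.bdL (A.sec e l) = e * A.bdL l * e⁻¹ := by
  simp [sec, A.bdL_lift, A.bdE_bdL, mul_assoc]

theorem sec_bdL (k l : L) : A.sec (A.bdL k) l = k * l * k⁻¹ := by
  rw [sec, ← map_inv, A.lift_bdL_bdL]; group

theorem sec_mul (e : E) (l k : L) : A.sec e (l * k) = A.sec e l * A.sec e k := by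
  have h1 : (A.bdL l)⁻¹ * e * ((A.bdL l)⁻¹)⁻¹ = A.bdL (A.lift (A.bdL l)⁻¹ e) * e := by
    simp [A.bdL_lift, A.bdE_bdL, mul_assoc]
  have h2 : A.lift (A.bdL (l * k))⁻¹ e
      = A.lift (A.bdL k)⁻¹ (A.bdL (A.lift (A.bdL l)⁻¹ e) * e) * A.lift (A.bdL l)⁻¹ e := by
    rw [map_mul, mul_inv_rev, A.lift_mul_left, h1]
    simp [A.bdE_bdL]
  rw [sec, h2, A.lift_mul_right']
  simp only [map_inv, A.bdE_bdL, inv_one, map_one, MulAut.one_apply, A.sec_bdL]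
  rw [← map_inv A.bdL k, A.lift_bdL_bdL, map_inv A.bdL k]
  simp only [sec]
  group

theorem mul_sec (e f : E) (l : L) : A.sec (e * f) l = A.sec e (A.sec f l) := by
  conv_lhs => rw [sec, A.lift_mul_right']
  have : A.sec f l = l * A.lift (A.bdL l)⁻¹ f := rfl
  rw [this, A.sec_mul]
  simp [A.bdE_bdL, sec, mul_assoc]

theorem act_sec (g : G) (e : E) (l : L) :
    A.actL g (A.sec e l) = A.sec (A.actE g e) (A.actL g l) := by
  simp [sec, A.act_lift, A.bdL_act]

/-- The secondary action of `E` on `L` by automorphisms. -/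
def secAct : E →* MulAut L where
  toFun e :=
    { toFun := A.sec e
      invFun := A.sec e⁻¹
      left_inv := fun l => by rw [← A.mul_sec, inv_mul_cancel, A.sec_one]
      right_inv := fun l => by rw [← A.mul_sec, mul_inv_cancel, A.sec_one]
      map_mul' := A.sec_mul e }
  map_one' := by ext l; exact A.sec_one l
  map_mul' e f := by ext l; exact A.mul_sec e f l

@[simp] theorem secAct_apply (e : E) (l : L) : A.secAct e l = A.sec e l := rfl

/-- `(1_G, x) • (1, e, k) = (1, x e x⁻¹, {x, e⁻¹} (∂ x ▷ k))`, where `(1, e, k)` is written as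
the element `(e, k)` of `E ⋉ L`. -/
def liftedE (x : E) (v : SDP A.secAct) : SDP A.secAct :=
  ⟨x * v.fst * x⁻¹, A.lift x v.fst⁻¹ * A.actL (A.bdE x) v.snd⟩

/-- `g • (1, e, k) = (1, g ▷ e, g ▷ k)`. -/
def liftedG (g : G) (v : SDP A.secAct) : SDP A.secAct := ⟨A.actE g v.fst, A.actL g v.snd⟩

theorem lift_mul_comm (x f : E) (k : L) :
    A.lift x f * A.actL (A.bdE x) (A.sec f k)
      = A.sec (x * f * x⁻¹) (A.actL (A.bdE x) k) * A.lift x f := by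
  have h : x * f * x⁻¹ = A.bdL (A.lift x f) * A.actE (A.bdE x) f := by
    simp [A.bdL_lift]
  rw [h, A.mul_sec, A.sec_bdL, A.act_sec]
  group

theorem lift_mul_right'' (x f g : E) :
    A.lift x (f * g) = A.sec (x * f * x⁻¹) (A.lift x g) * A.lift x f := by
  have h : x * f * x⁻¹ = A.bdL (A.lift x f) * A.actE (A.bdE x) f := by
    simp [A.bdL_lift]
  rw [h, A.mul_sec, A.sec_bdL, A.lift_mul_right']
  group

theorem liftedE_map_mul (x : E) (v w : SDP A.secAct) :
    A.liftedE x (v * w) = A.liftedE x v * A.liftedE x w := by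
  ext
  · simp [liftedE]
  · have h := A.lift_mul_comm x w.fst⁻¹ v.snd
    have e : (x * w.fst * x⁻¹)⁻¹ = x * w.fst⁻¹ * x⁻¹ := by group
    change A.lift x (v.fst * w.fst)⁻¹ * A.actL (A.bdE x) (A.sec w.fst⁻¹ v.snd * w.snd)
      = A.sec (x * w.fst * x⁻¹)⁻¹ (A.lift x v.fst⁻¹ * A.actL (A.bdE x) v.snd)
        * (A.lift x w.fst⁻¹ * A.actL (A.bdE x) w.snd)
    rw [mul_inv_rev, A.lift_mul_right'', map_mul, A.sec_mul, e]
    simp only [← mul_assoc]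
    rw [mul_assoc _ (A.lift x w.fst⁻¹) (A.actL _ (A.sec _ _)), h]
    simp only [mul_assoc]

theorem liftedG_map_mul (g : G) (v w : SDP A.secAct) :
    A.liftedG g (v * w) = A.liftedG g v * A.liftedG g w := by
  ext
  · simp [liftedG]
  · change A.actL g (A.sec w.fst⁻¹ v.snd * w.snd)
      = A.sec (A.actE g w.fst)⁻¹ (A.actL g v.snd) * A.actL g w.snd
    rw [map_mul, A.act_sec, map_inv]

theorem liftedE_liftedE (x y : E) (v : SDP A.secAct) :
    A.liftedE (x * y) v = A.liftedE x (A.liftedE y v) := by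
  ext
  · simp [liftedE, mul_assoc]
  · simp only [liftedE, A.lift_mul_left, map_mul, MulAut.mul_apply, mul_inv_rev, inv_inv, mul_assoc]

theorem liftedE_one (v : SDP A.secAct) : A.liftedE 1 v = v := by
  ext <;> simp [liftedE, A.lift_one_left]

theorem liftedG_liftedE (g : G) (x : E) (v : SDP A.secAct) :
    A.liftedG g (A.liftedE x v) = A.liftedE (A.actE g x) (A.liftedG g v) := by
  ext
  · simp [liftedE, liftedG]
  · simp [liftedE, liftedG, A.act_lift, A.bdE_act]

/-- `(g, x) • (1, e, k) = (1, g ▷ (x e x⁻¹), g ▷ ({x, e⁻¹} (∂ x ▷ k)))`. -/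
def liftedFun (u : SDP A.actE) (v : SDP A.secAct) : SDP A.secAct :=
  A.liftedG u.fst (A.liftedE u.snd v)

theorem liftedFun_one (v : SDP A.secAct) : A.liftedFun 1 v = v := by
  ext <;> simp [liftedFun, A.liftedE_one, liftedG]

theorem liftedFun_mul (u u' : SDP A.actE) (v : SDP A.secAct) :
    A.liftedFun (u * u') v = A.liftedFun u (A.liftedFun u' v) := by
  have h : ∀ (g h : G) (v : SDP A.secAct),
      A.liftedG (g * h) v = A.liftedG g (A.liftedG h v) := by
    intro g h v; ext <;> simp [liftedG]
  simp only [liftedFun, SDP.mul_fst, SDP.mul_snd]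
  rw [h, A.liftedE_liftedE, A.liftedG_liftedE u'.fst, A.liftedG_liftedE u'.fst]
  simp

/-- The first lifted action `•` of `G ⋉ E` on the subgroup `{1} ⋉ (E ⋉ L)` of `E ⋉ (E ⋉ L)`,
which is identified with `E ⋉ L`. -/
def lifted : SDP A.actE →* MulAut (SDP A.secAct) where
  toFun u :=
    { toFun := A.liftedFun u
      invFun := A.liftedFun u⁻¹
      left_inv := fun v => by rw [← A.liftedFun_mul, inv_mul_cancel, A.liftedFun_one]
      right_inv := fun v => by rw [← A.liftedFun_mul, mul_inv_cancel, A.liftedFun_one]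
      map_mul' := fun v w => by
        simp only [liftedFun, A.liftedE_map_mul, A.liftedG_map_mul] }
  map_one' := by ext1 v; exact A.liftedFun_one v
  map_mul' u v := by ext1 w; exact A.liftedFun_mul u v w

/-- The underlying group `(G ⋉ E) ⋉ ({1} ⋉ (E ⋉ L))` of the triangle space of `A`. The element
`(g, x, 1, e, k)` is `⟨⟨g, x⟩, ⟨e, k⟩⟩`. -/
abbrev Triangle₀ : Type _ := SDP A.lifted

end Basic

/-! ### Morphisms -/

/-- A morphism `(μ, ψ, φ)` of 2-crossed modules. -/
structure Hom {L E G L' E' G' : Type*} [Group L] [Group E] [Group G] [Group L'] [Group E']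
    [Group G'] (A : TwoCrossedModule L E G) (A' : TwoCrossedModule L' E' G') where
  /-- the component `L → L'` -/
  μ : L →* L'
  /-- the component `E → E'` -/
  ψ : E →* E'
  /-- the component `G → G'` -/
  φ : G →* G'
  bdL_μ : ∀ l, A'.bdL (μ l) = ψ (A.bdL l)
  bdE_ψ : ∀ e, A'.bdE (ψ e) = φ (A.bdE e)
  ψ_act : ∀ g e, ψ (A.actE g e) = A'.actE (φ g) (ψ e)
  μ_act : ∀ g l, μ (A.actL g l) = A'.actL (φ g) (μ l)
  μ_lift : ∀ e f, μ (A.lift e f) = A'.lift (ψ e) (ψ f)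

/-- Composition of morphisms: `f.comp h = f ∘ h`. -/
def Hom.comp {L₁ E₁ G₁ L₂ E₂ G₂ L₃ E₃ G₃ : Type*} [Group L₁] [Group E₁] [Group G₁]
    [Group L₂] [Group E₂] [Group G₂] [Group L₃] [Group E₃] [Group G₃]
    {A₁ : TwoCrossedModule L₁ E₁ G₁} {A₂ : TwoCrossedModule L₂ E₂ G₂}
    {A₃ : TwoCrossedModule L₃ E₃ G₃} (f : Hom A₂ A₃) (h : Hom A₁ A₂) : Hom A₁ A₃ where
  μ := f.μ.comp h.μ
  ψ := f.ψ.comp h.ψ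
  φ := f.φ.comp h.φ
  bdL_μ l := by simp [f.bdL_μ, h.bdL_μ]
  bdE_ψ e := by simp [f.bdE_ψ, h.bdE_ψ]
  ψ_act g e := by simp [f.ψ_act, h.ψ_act]
  μ_act g l := by simp [f.μ_act, h.μ_act]
  μ_lift e e' := by simp [f.μ_lift, h.μ_lift]

/-! ### Homotopies -/

section Homotopy

variable {L E G L' E' G' : Type*} [Group L] [Group E] [Group G] [Group L'] [Group E'] [Group G']
  {A : TwoCrossedModule L E G} {A' : TwoCrossedModule L' E' G'}

/-- Quadratic `f`-derivations `(s, t)`. -/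
structure IsQuadraticDerivation (f : Hom A A') (s : G → E') (t : E → L') : Prop where
  map_s_mul : ∀ g h, s (g * h) = A'.actE (f.φ h)⁻¹ (s g) * s h
  map_t_mul : ∀ a b, t (a * b) =
    A'.sec (f.ψ b * s (A.bdE b))⁻¹
      (A'.lift (f.ψ b) (A'.actE (f.φ (A.bdE b))⁻¹ (s (A.bdE a))⁻¹) * t a) * t b
  map_t_act : ∀ g a, t (A.actE g a) =
    A'.actL (f.φ g) (A'.sec (s g * (s (A.bdE a))⁻¹) (A'.lift (f.ψ a)⁻¹ (s g)⁻¹)⁻¹)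
      * A'.actL (f.φ g) (A'.lift (s g) ((s (A.bdE a))⁻¹ * (f.ψ a)⁻¹))
      * A'.actL (f.φ g * A'.bdE (s g)) (t a)

/-- A homotopy `(f, s, t)` connecting `f` and `f'`. -/
@[ext]
structure Homotopy (f f' : Hom A A') where
  /-- the map `s : G → E'` -/
  s : G → E'
  /-- the map `t : E → L'` -/
  t : E → L'
  isQuadraticDerivation : IsQuadraticDerivation f s t
  μ_eq : ∀ l, f'.μ l = f.μ l * t (A.bdL l)
  ψ_eq : ∀ a, f'.ψ a = f.ψ a * s (A.bdE a) * A'.bdL (t a)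
  φ_eq : ∀ g, f'.φ g = f.φ g * A'.bdE (s g)

/-! Concatenation and inversion of homotopies when `G` is free on a chosen basis `b`. -/

variable {ι : Type*} (b : FreeGroupBasis ι G)

/-- The unique `f.φ`-derivation `G → E'` with prescribed values `s₀` on the basis: the second
component of the group map `G → G' ⋉ E'` sending `b i` to `(f.φ (b i), s₀ i)`. -/
noncomputable def extendDerivation (f : Hom A A') (s₀ : ι → E') : G → E' :=
  fun g => (b.lift (fun i => (⟨f.φ (b i), s₀ i⟩ : SDP A'.actE)) g).snd

/-- `s ⊗ s'`, the derivation with `(s ⊗ s')(b) = s(b) s'(b)` on the basis. -/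
noncomputable def concatS (f : Hom A A') (s s' : G → E') : G → E' :=
  extendDerivation b f (fun i => s (b i) * s' (b i))

/-- The group map `X : G → Gr₀(𝒯(A'))` with `b ↦ (f.φ(b), s(b), 1, s'(b), 1)` on the basis. -/
noncomputable def triangleMap (f : Hom A A') (s s' : G → E') : G →* A'.Triangle₀ :=
  b.lift (fun i => ⟨⟨f.φ (b i), s (b i)⟩, ⟨s' (b i), 1⟩⟩)

/-- The map `ω : G → L'`, the last component of the group map `X`. -/
noncomputable def omega (f : Hom A A') (s s' : G → E') : G → L' :=
  fun g => (triangleMap b f s s' g).snd.snd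

/-- `(t ⊗ t')(e) = ω(∂ e) (s'(∂ e)⁻¹ ▷' t(e)) t'(e)`. -/
noncomputable def concatT (f : Hom A A') (s s' : G → E') (t t' : E → L') : E → L' :=
  fun e => omega b f s s' (A.bdE e) * A'.sec (s' (A.bdE e))⁻¹ (t e) * t' e

/-- `s̄`, the `f'.φ`-derivation with `s̄(b) = s(b)⁻¹` on the basis. -/
noncomputable def invS (f' : Hom A A') (s : G → E') : G → E' :=
  extendDerivation b f' (fun i => (s (b i))⁻¹)

/-- `t̄(e) = ω^{(s, s̄)}(∂ e)⁻¹ (s(∂ e) ▷' t(e)⁻¹)`. -/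
noncomputable def invT (f f' : Hom A A') (s : G → E') (t : E → L') : E → L' :=
  fun e => (omega b f s (invS b f' s) (A.bdE e))⁻¹ * A'.sec (s (A.bdE e)) (t e)⁻¹

variable {f f' f'' : Hom A A'}

/-- `K` is the concatenation `H ⊗ H'` (with respect to the basis `b`). -/
def IsConcat (H : Homotopy f f') (H' : Homotopy f' f'') (K : Homotopy f f'') : Prop :=
  K.s = concatS b f H.s H'.s ∧ K.t = concatT b f H.s H'.s H.t H'.t

/-- `K` is the homotopy `H̄` (with respect to the basis `b`). -/
def IsBar (H : Homotopy f f') (K : Homotopy f' f) : Prop :=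
  K.s = invS b f' H.s ∧ K.t = invT b f f' H.s H.t

/-- `K` is a two-sided inverse of `H` for the concatenation: `H ⊗ K` and `K ⊗ H` are the
trivial homotopies, whose components are constant with value `1`. -/
def IsInverse (H : Homotopy f f') (K : Homotopy f' f) : Prop :=
  (concatS b f H.s K.s = (fun _ => 1) ∧ concatT b f H.s K.s H.t K.t = (fun _ => 1)) ∧
  (concatS b f' K.s H.s = (fun _ => 1) ∧ concatT b f' K.s H.s K.t H.t = (fun _ => 1))

end Homotopy

/-! ### The resolution `Q¹(A)` and lax homotopies -/

section Lax

variable {L E G L' E' G' : Type*} [Group L] [Group E] [Group G] [Group L'] [Group E'] [Group G']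

/-- The projection `p` from the free group on the underlying set of `G` to `G`. -/
def freeProj (G : Type*) [Group G] : FreeGroup G →* G := FreeGroup.lift id

/-- The group `E ×_G F(G) = {(e, u) : ∂ e = p u}`, where `F(G)` is the free group on the
underlying set of `G`. -/
def pull (A : TwoCrossedModule L E G) : Subgroup (E × FreeGroup G) where
  carrier := {x | A.bdE x.1 = freeProj G x.2}
  mul_mem' := by
    intro a b ha hb
    change A.bdE a.1 = freeProj G a.2 at ha
    change A.bdE b.1 = freeProj G b.2 at hb
    change A.bdE (a.1 * b.1) = freeProj G (a.2 * b.2)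
    rw [map_mul, map_mul, ha, hb]
  one_mem' := by simp
  inv_mem' := by
    intro a ha
    change A.bdE a.1 = freeProj G a.2 at ha
    change A.bdE a.1⁻¹ = freeProj G a.2⁻¹
    rw [map_inv, map_inv, ha]

theorem mem_pull (A : TwoCrossedModule L E G) (x : E × FreeGroup G) :
    x ∈ A.pull ↔ A.bdE x.1 = freeProj G x.2 := Iff.rfl

/-- `u ▷ (e, u') = (p(u) ▷ e, u u' u⁻¹)`. -/
def pullAct (A : TwoCrossedModule L E G) (u : FreeGroup G) (x : A.pull) : A.pull :=
  ⟨(A.actE (freeProj G u) x.1.1, u * x.1.2 * u⁻¹), by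
    have hx := (A.mem_pull _).1 x.2
    rw [mem_pull]
    simp [A.bdE_act, hx]⟩

theorem pullAct_mul (A : TwoCrossedModule L E G) (u v : FreeGroup G) (x : A.pull) :
    A.pullAct (u * v) x = A.pullAct u (A.pullAct v x) := by
  ext1; ext1 <;> simp [pullAct, mul_assoc]

theorem pullAct_one (A : TwoCrossedModule L E G) (x : A.pull) : A.pullAct 1 x = x := by
  ext1; ext1 <;> simp [pullAct]

theorem pullAct_map_mul (A : TwoCrossedModule L E G) (u : FreeGroup G) (x y : A.pull) :
    A.pullAct u (x * y) = A.pullAct u x * A.pullAct u y := by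
  ext1; ext1 <;> simp [pullAct]

/-- The 2-crossed module `Q¹(A) = (L → E ×_G F(G) → F(G))`, with `δ'(k) = (δ k, ∅)`,
`∂'(e, u) = u`, `u ▷ (e, u') = (p(u) ▷ e, u u' u⁻¹)`, `u ▷ k = p(u) ▷ k` and
`{(e, u), (e', u')} = {e, e'}`. -/
def Q1 (A : TwoCrossedModule L E G) : TwoCrossedModule L A.pull (FreeGroup G) where
  bdL := MonoidHom.mk' (fun k => ⟨(A.bdL k, 1), by rw [mem_pull]; simp [A.bdE_bdL]⟩) (by
    intro k l; ext1; ext1 <;> simp)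
  bdE := (MonoidHom.snd E (FreeGroup G)).comp A.pull.subtype
  actE :=
    { toFun := fun u =>
        { toFun := A.pullAct u
          invFun := A.pullAct u⁻¹
          left_inv := fun x => by rw [← pullAct_mul, inv_mul_cancel, pullAct_one]
          right_inv := fun x => by rw [← pullAct_mul, mul_inv_cancel, pullAct_one]
          map_mul' := A.pullAct_map_mul u }
      map_one' := by ext1 x; exact A.pullAct_one x
      map_mul' := fun u v => by ext1 x; exact A.pullAct_mul u v x }
  actL := A.actL.comp (freeProj G)
  lift x y := A.lift x.1.1 y.1.1
  bdE_bdL l := rfl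
  bdE_act u x := rfl
  bdL_act u l := by
    apply Subtype.ext
    ext1
    · exact A.bdL_act _ _
    · change (1 : FreeGroup G) = u * 1 * u⁻¹
      simp
  act_lift u x y := A.act_lift _ _ _
  bdL_lift x y := by
    have hx := (A.mem_pull _).1 x.2
    apply Subtype.ext
    ext1
    · change A.bdL (A.lift x.1.1 y.1.1)
        = x.1.1 * y.1.1 * x.1.1⁻¹ * A.actE (freeProj G x.1.2) y.1.1⁻¹
      rw [A.bdL_lift, hx]
    · change (1 : FreeGroup G) = x.1.2 * y.1.2 * x.1.2⁻¹ * (x.1.2 * y.1.2⁻¹ * x.1.2⁻¹)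
      group
  lift_bdL_bdL l k := A.lift_bdL_bdL l k
  lift_bdL_mul l x := by
    have hx := (A.mem_pull _).1 x.2
    change _ = l * A.actL (freeProj G x.1.2) l⁻¹
    rw [← hx]
    exact A.lift_bdL_mul l x.1.1
  lift_mul_left x y z := by
    have hx := (A.mem_pull _).1 x.2
    change _ = _ * A.actL (freeProj G x.1.2) _
    rw [← hx]
    exact A.lift_mul_left x.1.1 y.1.1 z.1.1
  lift_mul_right x y z := by
    have hx := (A.mem_pull _).1 x.2
    change _ = _ * (_ * A.lift (A.bdL (A.lift x.1.1 z.1.1))⁻¹ (A.actE (freeProj G x.1.2) y.1.1))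
    rw [← hx]
    exact A.lift_mul_right x.1.1 y.1.1 z.1.1

/-- The projection `proj = (id, (e, u) ↦ e, p) : Q¹(A) → A`. -/
def proj (A : TwoCrossedModule L E G) : Hom A.Q1 A where
  μ := MonoidHom.id L
  ψ := (MonoidHom.fst E (FreeGroup G)).comp A.pull.subtype
  φ := freeProj G
  bdL_μ _ := rfl
  bdE_ψ x := (A.mem_pull _).1 x.2
  ψ_act _ _ := rfl
  μ_act _ _ := rfl
  μ_lift _ _ := rfl

/-- The chosen basis `[G] = {[g] : g ∈ G}` of the free group underlying `Q¹(A)`. -/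
def stdBasis (G : Type*) : FreeGroupBasis G (FreeGroup G) := FreeGroupBasis.ofFreeGroup G

variable {A : TwoCrossedModule L E G} {A' : TwoCrossedModule L' E' G'} {f f' : Hom A A'}

/-- A lax homotopy connecting `f, f' : A → A'` is a homotopy connecting
`f ∘ proj, f' ∘ proj : Q¹(A) → A'`. -/
abbrev LaxHomotopy (f f' : Hom A A') : Type _ := Homotopy (f.comp A.proj) (f'.comp A.proj)

/-- The element `[e] = (e, [∂ e])` of `E ×_G F(G)`. -/
def genE (A : TwoCrossedModule L E G) (e : E) : A.pull :=
  ⟨(e, FreeGroup.of (A.bdE e)), by rw [mem_pull]; simp [freeProj]⟩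

/-- The element `(g, h) = (1, [gh]⁻¹ [g] [h])` of `E ×_G F(G)`. -/
def genPair (A : TwoCrossedModule L E G) (g h : G) : A.pull :=
  ⟨(1, (FreeGroup.of (g * h))⁻¹ * FreeGroup.of g * FreeGroup.of h), by
    rw [mem_pull]; simp [freeProj, mul_assoc]⟩

/-- The component `ŝ : G → E'` of a lax homotopy, `ŝ(g) = s([g])`. -/
def Homotopy.sHat (H : LaxHomotopy f f') (g : G) : E' := H.s (FreeGroup.of g)

/-- The component `t̂ : E → L'` of a lax homotopy, `t̂(e) = t(e, [∂ e])`. -/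
def Homotopy.tHat (H : LaxHomotopy f f') (e : E) : L' := H.t (A.genE e)

/-- The component `Π : G × G → L'` of a lax homotopy, `Π(g, h) = t(1, [gh]⁻¹ [g] [h])`. -/
def Homotopy.piHat (H : LaxHomotopy f f') (g h : G) : L' := H.t (A.genPair g h)

/-- `H` is the lax homotopy with components `(ŝ, t̂, Π) = (s₀, t₀, P₀)`, and the only one
connecting `f` and `f'` with these components. -/
def HasUniqueForm (H : LaxHomotopy f f') (s₀ : G → E') (t₀ : E → L') (P₀ : G → G → L') : Prop :=
  ((∀ g, H.sHat g = s₀ g) ∧ (∀ e, H.tHat e = t₀ e) ∧ (∀ g h, H.piHat g h = P₀ g h)) ∧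
  ∀ K : LaxHomotopy f f', (∀ g, K.sHat g = s₀ g) → (∀ e, K.tHat e = t₀ e) →
    (∀ g h, K.piHat g h = P₀ g h) → K = H

/-- The expression `Θ^{(s, s')}(x, y, z)`, for group maps `φ φ' : X → G'` and maps
`s s' : X → E'`. -/
def theta {X : Type*} [Group X] (A' : TwoCrossedModule L' E' G') (φ φ' : X →* G')
    (s s' : X → E') (x y z : X) : L' :=
  A'.sec (s' z)⁻¹ (A'.lift (s z)⁻¹ (A'.actE (φ z)⁻¹ (s' y)⁻¹)) *
  A'.sec (A'.actE (φ' z)⁻¹ (s' y) * s' z)⁻¹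
    (A'.lift (A'.actE (φ z)⁻¹ (s y) * s z)⁻¹
        (A'.actE ((φ (y * z))⁻¹ * φ x) (s x * s' x * (s x)⁻¹)) *
      A'.actL ((φ' (y * z))⁻¹ * φ x) (A'.lift (s x) (s' x)))

end Lax

end TwoCrossedModule

/-! An element `l` of `L` is read as an arrow `a → a δ(l)` between elements of `E`. Composition is
the product of `L`, left multiplication by an element of `E` does not change the label `l`, and
right multiplication by `e` turns it into `e⁻¹ ▷' l`, which is `rightSec e l`. The Peiffer lifting
becomes an interchange arrow `swap q z : q (∂(q)⁻¹ ▷ z) → z q`, natural in both variables and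
subject to two hexagon identities. Identities between products in `L` are then comparisons of paths.

The group map defining `ω` has a neighbouring component `σ` (`sigma`), and freeness gives `s ⊗ s' =
s σ` and `s' = σ δ(ω)`. Hence `t ⊗ t'` is the composite path `ψ s σ → ψ s s' → ψ' s' → ψ''`, with
steps `ω`, `t` whiskered by `s'`, and `t'`. Chasing these paths shows that, over a homotopy `(s,
t)`, the pair `(s ⊗ s', t ⊗ t')` is a quadratic derivation exactly when `(s', t')` is one
(`isQuadraticDerivation_concat_iff`). One direction makes concatenation a homotopy. The other
produces the inverse, since `(s̄, t̄)` concatenates with `(s, t)` to the trivial pair. That it is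
inverse on the other side as well rests on `ω^{(s̄, s)} = s⁻¹ ▷' ω^{(s, s̄)}` (`omega_invS_swap`).

For lax homotopies, `ω` is `1` on basis elements and `Θ` on the relators `[gh]⁻¹[g][h]`
(`omega_genPair`), which gives the component formulas. Uniqueness holds because the elements `(e,
[∂e])` and `(1, [gh]⁻¹[g][h])` generate `E ×_G F(G)` under the action of `F(G)`
(`mem_of_generators`). -/

namespace TwoCrossedModule

/-! ### Arrow calculus in a 2-crossed module: whiskering and interchange. -/

section Swap

variable {L E G : Type*} [Group L] [Group E] [Group G] (A : TwoCrossedModule L E G)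

/-- The right action of `E` on `L` underlying `▷'`: whiskering an arrow on the right by `e`. -/
def rightSec (e : E) : MulAut L := A.secAct e⁻¹

/-- The right action `z ↦ ∂(q)⁻¹ ▷ z` of `E` on itself. -/
def rightE (q : E) : MulAut E := A.actE (A.bdE q)⁻¹

/-- The right action `l ↦ ∂(q)⁻¹ ▷ l` of `E` on `L`. -/
def rightL (q : E) : MulAut L := A.actL (A.bdE q)⁻¹

/-- The interchange arrow `q (∂(q)⁻¹ ▷ z) → z q` given by the Peiffer lifting. -/
def swap (q z : E) : L := A.rightSec q (A.lift q (A.rightE q z)⁻¹)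

theorem rightSec_def (e : E) (l : L) : A.rightSec e l = A.sec e⁻¹ l := rfl

theorem rightE_def (q z : E) : A.rightE q z = A.actE (A.bdE q)⁻¹ z := rfl

theorem rightL_def (q : E) (l : L) : A.rightL q l = A.actL (A.bdE q)⁻¹ l := rfl

theorem rightSec_one (l : L) : A.rightSec 1 l = l := by simp [rightSec]

theorem rightSec_mul (e f : E) (l : L) :
    A.rightSec (e * f) l = A.rightSec f (A.rightSec e l) := by
  simp only [rightSec, mul_inv_rev, map_mul, MulAut.mul_apply]

theorem rightSec_inv_self (e : E) (l : L) : A.rightSec e⁻¹ (A.rightSec e l) = l := by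
  rw [← rightSec_mul, mul_inv_cancel, rightSec_one]

theorem rightSec_self_inv (e : E) (l : L) : A.rightSec e (A.rightSec e⁻¹ l) = l := by
  rw [← rightSec_mul, inv_mul_cancel, rightSec_one]

theorem sec_eq_rightSec (e : E) (l : L) : A.sec e l = A.rightSec e⁻¹ l := by
  rw [rightSec_def, inv_inv]

theorem bdL_rightSec (e : E) (l : L) : A.bdL (A.rightSec e l) = e⁻¹ * A.bdL l * e := by
  simp [rightSec_def, A.bdL_sec]

theorem rightE_mul (q r z : E) : A.rightE (q * r) z = A.rightE r (A.rightE q z) := by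
  simp only [rightE, map_mul, mul_inv_rev, MulAut.mul_apply]

theorem rightL_mul (q r : E) (l : L) : A.rightL (q * r) l = A.rightL r (A.rightL q l) := by
  simp only [rightL, map_mul, mul_inv_rev, MulAut.mul_apply]

theorem rightE_one (z : E) : A.rightE 1 z = z := by simp [rightE]

theorem rightE_bdL (l : L) (z : E) : A.rightE (A.bdL l) z = z := by
  simp [rightE, A.bdE_bdL]

theorem rightL_bdL (l k : L) : A.rightL (A.bdL l) k = k := by
  simp [rightL, A.bdE_bdL]

theorem bdL_rightL (q : E) (l : L) : A.bdL (A.rightL q l) = A.rightE q (A.bdL l) :=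
  A.bdL_act _ _

theorem rightL_rightSec (q e : E) (l : L) :
    A.rightL q (A.rightSec e l) = A.rightSec (A.rightE q e) (A.rightL q l) := by
  rw [rightSec_def, rightL_def, rightE_def, A.act_sec, map_inv]
  rfl

/-- The interchange law: for `l : a → b`, the arrow `k` may be applied in the left factor before or
after `l` is applied in the right one. -/
theorem mul_rightSec_target {a b : E} {l : L} (h : a * A.bdL l = b) (k : L) :
    l * A.rightSec b k = A.rightSec a k * l := by
  subst h
  rw [rightSec_mul, rightSec_def _ (A.bdL l), ← map_inv, sec_bdL]
  group

theorem mul_rightSec_bdL (a : E) (l k : L) :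
    l * A.rightSec (a * A.bdL l) k = A.rightSec a k * l := A.mul_rightSec_target rfl k

theorem bdL_swap (q z : E) : q * A.rightE q z * A.bdL (A.swap q z) = z * q := by
  rw [swap, bdL_rightSec, bdL_lift, rightE]
  simp [mul_assoc]

/-- First hexagon: `q` moves past `z w` by passing `z` and then `w`. -/
theorem swap_mul_right (q z w : E) :
    A.swap q (z * w) = A.rightSec (A.rightE q w) (A.swap q z) * A.swap q w := by
  simp only [swap]
  rw [map_mul, mul_inv_rev, lift_mul_right'', map_mul, ← rightSec_mul, sec_eq_rightSec,
    ← rightSec_mul]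
  congr 3
  group

/-- The definition of `▷'` already gives `{δ l, q}`; cancelling it from the axiom for `{δ l, q}{q, δ
l}` leaves this formula. -/
theorem lift_bdL_right (q : E) (l : L) :
    A.lift q (A.bdL l) = A.sec q l * A.actL (A.bdE q) l⁻¹ := by
  have h := A.lift_bdL_mul l q
  have h2 : A.sec q l⁻¹ = l⁻¹ * A.lift (A.bdL l) q := by simp [sec]
  have h3 : A.sec q l⁻¹ = (A.sec q l)⁻¹ := map_inv (A.secAct q) l
  rw [h3] at h2
  have h4 : A.lift (A.bdL l) q = l * (A.sec q l)⁻¹ := by rw [h2]; group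
  rw [h4, mul_assoc] at h
  have := mul_left_cancel h
  rw [← this]; group

theorem lift_bdL_left (q : E) (l : L) : A.lift (A.bdL l) q = l * A.sec q l⁻¹ := by
  simp [sec]

/-- Rewrites the axiom for `{q r, f}` in the form needed for the second hexagon, by splitting `r f
r⁻¹` as `δ{r, f} (∂(r) ▷ f)`. -/
theorem lift_swap_compat (q r f : E) :
    A.lift q (r * f * r⁻¹) * A.actL (A.bdE q) (A.lift r f)
      = A.sec q (A.lift r f) * A.lift q (A.actE (A.bdE r) f) := by
  have h : r * f * r⁻¹ = A.bdL (A.lift r f) * A.actE (A.bdE r) f := by simp [A.bdL_lift]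
  rw [h, lift_mul_right'', ← A.bdL_sec, sec_bdL, lift_bdL_right, map_inv]
  group

/-- Second hexagon: `q r` moves past `z` by letting `r` pass and then `q`. -/
theorem swap_mul_left (q r z : E) :
    A.swap (q * r) z = A.swap r (A.rightE q z) * A.rightSec r (A.swap q z) := by
  have h := A.lift_swap_compat q r (A.rightE (q * r) z)⁻¹
  rw [← A.lift_mul_left] at h
  simp only [swap]
  rw [h, rightSec_mul, map_mul, map_mul, sec_eq_rightSec, rightSec_self_inv, rightE_mul]
  simp [rightE_def]

theorem swap_one_left (z : E) : A.swap 1 z = 1 := by simp [swap, lift_one_left]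

theorem swap_one_right (q : E) : A.swap q 1 = 1 := by simp [swap, lift_one_right]

theorem swap_bdL_right (q : E) (m : L) :
    A.swap q (A.bdL m) = (A.rightL q m)⁻¹ * A.rightSec q m := by
  rw [swap, ← bdL_rightL, ← map_inv, lift_bdL_right, map_mul, sec_eq_rightSec,
    rightSec_self_inv, rightL_def]
  simp

theorem swap_bdL_left (l : L) (z : E) :
    A.swap (A.bdL l) z = (A.rightSec z l)⁻¹ * l := by
  rw [swap, rightE_bdL, lift_bdL_left, ← rightSec_def, rightSec_def, ← map_inv A.bdL, sec_bdL,
    map_inv]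
  group

/-- Naturality of the interchange arrow in its second variable. -/
theorem swap_mul_rightSec (q z : E) (m : L) :
    A.swap q z * A.rightSec q m = A.rightL q m * A.swap q (z * A.bdL m) := by
  have h := A.mul_rightSec_bdL 1 (A.rightL q m) (A.swap q z)
  rw [one_mul, rightSec_one, bdL_rightL] at h
  rw [swap_mul_right, ← mul_assoc, h, swap_bdL_right]
  group

/-- Naturality in the first variable; the source is twisted by the same automorphism throughout
because `∂δ = 1`. -/
theorem swap_mul_eq (q z : E) (l : L) :
    A.swap q z * l = A.rightSec (A.rightE q z) l * A.swap (q * A.bdL l) z := by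
  have h := A.mul_rightSec_bdL 1 l (A.swap q z)
  rw [one_mul, rightSec_one] at h
  rw [swap_mul_left, swap_bdL_left, mul_assoc, h]
  group

/-- The second hexagon for `y y⁻¹ = 1`. It turns the liftings of inverses in the action rule and in
the triangle group into inverse interchange arrows. -/
theorem lift_inv_inv (y w : E) : A.lift y⁻¹ w⁻¹ = (A.swap y w)⁻¹ := by
  have h := A.swap_mul_left y y⁻¹ w
  have h2 : A.swap y⁻¹ (A.rightE y w) = A.rightSec y⁻¹ (A.lift y⁻¹ w⁻¹) := by
    simp [swap, rightE_def]
  rw [mul_inv_cancel, swap_one_left, h2, ← map_mul] at h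
  have h3 := congrArg (A.rightSec y) h
  rw [rightSec_self_inv, map_one] at h3
  exact eq_inv_of_mul_eq_one_left h3.symm

theorem rightSec_mul_swap (q z : E) (l : L) :
    A.rightSec (A.rightE q z) (A.rightSec q l) * A.swap q z
      = A.swap q z * A.rightSec q (A.rightSec z l) := by
  rw [← rightSec_mul, ← rightSec_mul, ← A.mul_rightSec_target (A.bdL_swap q z)]

/-- The multiplication rule for quadratic derivations is stable under concatenation. -/
theorem concat_mul_rule (q y x u v : E) (k l m n k' l' : L) :
    A.rightSec v ((A.swap y (A.rightE q u))⁻¹ * A.rightL (q * y) m) * n *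
      A.rightSec (A.rightE (q * y) (u * A.bdL m) * (v * A.bdL n))
        (A.rightSec y (A.swap q x) * A.rightSec (q * y) k * l) *
      (A.rightSec (v * A.bdL n) (A.swap (q * y * A.bdL l) (u * A.bdL m)) *
        A.rightSec (q * y * A.bdL l * (v * A.bdL n)) k' * l')
    = A.rightSec (y * v) (A.swap q (x * u)) *
        A.rightSec (q * (y * v)) (m * A.rightSec (u * A.bdL m) k * k') *
        (n * A.rightSec (v * A.bdL n) l * l') := by
  -- Dictionary for a product `a b`: `q = ψ(b)`, `y = s(∂b)`, `x = s(∂a)`, `u = σ(∂a)`, `v = σ(∂b)`,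
  -- `k = t(a)`, `l = t(b)`, `m = ω(∂a)`, `n = ω(∂b)`, `k' = t'(a)`, `l' = t'(b)`. Thus `x' =
  -- s'(∂a)`.
  obtain ⟨x', hx'⟩ : ∃ x', x' = u * A.bdL m := ⟨_, rfl⟩
  have e1 : A.rightSec (A.rightE (q * y) x') l * A.swap (q * y * A.bdL l) x' *
      A.rightSec (q * y * A.bdL l) k'
      = A.swap (q * y) x' * A.rightSec (q * y) k' * l := by
    rw [← swap_mul_eq, mul_assoc, mul_rightSec_bdL, mul_assoc]
  have e2 : A.rightSec (A.rightE (q * y) x') (A.rightSec (q * y) k) * A.swap (q * y) x'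
      = A.swap (q * y) x' * A.rightSec (q * y) (A.rightSec x' k) := A.rightSec_mul_swap _ _ _
  have e3 : A.rightL (q * y) m * A.rightSec (A.rightE (q * y) x') (A.rightSec y (A.swap q x))
      = A.rightSec (A.rightE (q * y) u) (A.rightSec y (A.swap q x)) * A.rightL (q * y) m := by
    rw [hx', map_mul, ← bdL_rightL, mul_rightSec_bdL]
  have e4 : A.rightL (q * y) m * A.swap (q * y) x'
      = A.swap (q * y) u * A.rightSec (q * y) m := by
    rw [hx', swap_mul_rightSec]
  have e5 : A.rightSec (A.rightE (q * y) u) (A.rightSec y (A.swap q x)) * A.swap (q * y) u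
      = A.swap y (A.rightE q u) * A.rightSec y (A.swap q (x * u)) := by
    rw [swap_mul_left, swap_mul_right, rightE_mul, ← mul_assoc, rightSec_mul_swap, map_mul,
      mul_assoc]
  have e6 : ∀ Z, n * A.rightSec (v * A.bdL n) Z = A.rightSec v Z * n := A.mul_rightSec_bdL v n
  have key : A.rightSec (A.rightE (q * y) x')
        (A.rightSec y (A.swap q x) * A.rightSec (q * y) k * l) *
      (A.swap (q * y * A.bdL l) x' * A.rightSec (q * y * A.bdL l) k')
      = A.rightSec (A.rightE (q * y) x') (A.rightSec y (A.swap q x)) * (A.swap (q * y) x' *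
        A.rightSec (q * y) (A.rightSec x' k * k')) * l := by
    rw [map_mul, map_mul, mul_assoc, ← mul_assoc (A.rightSec _ l), e1]
    simp only [map_mul, mul_assoc]
    rw [← mul_assoc (A.rightSec _ (A.rightSec (q * y) k)), e2]
    simp only [mul_assoc]
  have key2 : (A.swap y (A.rightE q u))⁻¹ * A.rightL (q * y) m *
      (A.rightSec (A.rightE (q * y) x') (A.rightSec y (A.swap q x)) * A.swap (q * y) x')
      = A.rightSec y (A.swap q (x * u)) * A.rightSec (q * y) m := by
    rw [mul_assoc, ← mul_assoc (A.rightL _ _), e3, mul_assoc, e4, ← mul_assoc (A.rightSec _ _), e5]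
    group
  rw [← hx']
  calc _ = A.rightSec v ((A.swap y (A.rightE q u))⁻¹ * A.rightL (q * y) m) * (n *
        A.rightSec (v * A.bdL n) (A.rightSec (A.rightE (q * y) x')
        (A.rightSec y (A.swap q x) * A.rightSec (q * y) k * l) *
      (A.swap (q * y * A.bdL l) x' * A.rightSec (q * y * A.bdL l) k'))) * l' := by
        simp only [rightSec_mul, map_mul, mul_assoc]
    _ = A.rightSec v ((A.swap y (A.rightE q u))⁻¹ * A.rightL (q * y) m *
      (A.rightSec (A.rightE (q * y) x') (A.rightSec y (A.swap q x)) * A.swap (q * y) x') *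
        A.rightSec (q * y) (A.rightSec x' k * k')) * A.rightSec v l * n * l' := by
        rw [key, e6]
        simp only [map_mul, mul_assoc]
    _ = _ := by
        rw [key2, mul_assoc _ _ n, ← e6]
        simp only [rightSec_mul, map_mul, mul_assoc]

theorem rightE_mul_bdL (q z : E) (l : L) : A.rightE (q * A.bdL l) z = A.rightE q z := by
  rw [rightE_mul, rightE_bdL]

theorem rightL_mul_bdL (q : E) (l k : L) : A.rightL (q * A.bdL l) k = A.rightL q k := by
  rw [rightL_mul, rightL_bdL]

theorem rightE_actE (q z : E) : A.rightE q (A.actE (A.bdE q) z) = z := by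
  simp [rightE_def]

theorem rightL_actL (q : E) (l : L) : A.rightL q (A.actL (A.bdE q) l) = l := by
  simp [rightL_def]

theorem swap_act_mul (z D : E) (Y : L) :
    A.swap z (A.actE (A.bdE z) D) * A.rightSec z (A.actL (A.bdE z) Y)
      = Y * A.swap z (A.actE (A.bdE z) (D * A.bdL Y)) := by
  rw [swap_mul_rightSec, rightL_actL, bdL_act, ← map_mul]

/-- The composite arrow `R(y) (swap q x) k (swap z (∂z ▷ p'))` of the action rule interacts with a
further interchange past `r`. -/
theorem swap_act_mul_act (z p r : E) :
    A.rightSec r (A.swap z (A.actE (A.bdE z) p)) * A.swap z (A.actE (A.bdE z) r)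
      = A.swap z (A.actE (A.bdE z) (p * r)) := by
  rw [map_mul, swap_mul_right, rightE_actE]

theorem swap_concat (z c Z : E) (w : L) :
    A.swap (c * A.bdL w) (A.rightE z Z) * A.rightSec (c * A.bdL w) (A.swap z Z) * w⁻¹
      = A.rightSec (A.rightE (z * c) Z) w⁻¹ * A.swap (z * c) Z := by
  rw [← swap_mul_left, map_inv, mul_inv_eq_iff_eq_mul, mul_assoc, swap_mul_eq,
    inv_mul_cancel_left, mul_assoc]

/-- The part of the action rule for a concatenation not involving the interchange with `p''`. -/
theorem concat_act_rule_aux (p x z u c : E) (k m w k' : L) :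
    A.rightSec u ((A.swap x (A.rightE p c))⁻¹ * A.rightL (p * x) w) * m *
      A.rightSec (A.rightE (p * x) (c * A.bdL w) * (u * A.bdL m))
        (A.rightSec x (A.swap p z) * k) *
      A.rightSec (u * A.bdL m) (A.swap (p * x * A.bdL k) (c * A.bdL w)) * k' *
      A.rightSec (p * x * A.bdL k * (u * A.bdL m) * A.bdL k') w⁻¹
    = A.rightSec (x * u) (A.swap p (z * c)) * (m * A.rightSec (u * A.bdL m) k * k') := by
  have e6 : ∀ Z, m * A.rightSec (u * A.bdL m) Z = A.rightSec u Z * m := A.mul_rightSec_bdL u m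
  have e7 := A.mul_rightSec_bdL (p * x * A.bdL k * (u * A.bdL m)) k' w⁻¹
  have e8 : A.swap (p * x * A.bdL k) (c * A.bdL w) * A.rightSec (p * x * A.bdL k) w⁻¹
      = (A.rightL (p * x) w)⁻¹ * A.swap (p * x * A.bdL k) c := by
    have h := A.swap_mul_rightSec (p * x * A.bdL k) c w
    rw [rightL_mul_bdL] at h
    rw [map_inv, mul_inv_eq_iff_eq_mul, mul_assoc (A.rightL _ _)⁻¹, h]
    group
  have e9 : ∀ Z, A.rightL (p * x) w * A.rightSec (A.rightE (p * x) (c * A.bdL w)) Z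
      = A.rightSec (A.rightE (p * x) c) Z * A.rightL (p * x) w := by
    intro Z
    rw [map_mul, ← bdL_rightL, mul_rightSec_bdL]
  have e10 : A.rightSec (A.rightE (p * x) c) (A.rightSec x (A.swap p z) * k) *
      A.swap (p * x * A.bdL k) c
      = A.swap x (A.rightE p c) * A.rightSec x (A.swap p (z * c)) * k := by
    rw [map_mul, mul_assoc, ← swap_mul_eq, swap_mul_left, rightE_mul]
    simp only [← mul_assoc]
    rw [rightSec_mul_swap, swap_mul_right, map_mul]
    simp only [← mul_assoc]
  calc _ = A.rightSec u ((A.swap x (A.rightE p c))⁻¹ * A.rightL (p * x) w) * (m *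
        A.rightSec (u * A.bdL m) (A.rightSec (A.rightE (p * x) (c * A.bdL w))
          (A.rightSec x (A.swap p z) * k) * A.swap (p * x * A.bdL k) (c * A.bdL w))) *
        (k' * A.rightSec (p * x * A.bdL k * (u * A.bdL m) * A.bdL k') w⁻¹) := by
        rw [map_mul (A.rightSec (u * A.bdL m)), ← rightSec_mul]
        simp only [mul_assoc]
    _ = A.rightSec u ((A.swap x (A.rightE p c))⁻¹ * A.rightL (p * x) w) * (m *
        A.rightSec (u * A.bdL m) (A.rightSec (A.rightE (p * x) (c * A.bdL w))
          (A.rightSec x (A.swap p z) * k) * (A.swap (p * x * A.bdL k) (c * A.bdL w) *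
          A.rightSec (p * x * A.bdL k) w⁻¹))) * k' := by
        rw [e7, rightSec_mul _ (p * x * A.bdL k)]
        simp only [map_mul, mul_assoc]
    _ = A.rightSec u ((A.swap x (A.rightE p c))⁻¹ * (A.rightL (p * x) w *
          A.rightSec (A.rightE (p * x) (c * A.bdL w))
          (A.rightSec x (A.swap p z) * k) * ((A.rightL (p * x) w)⁻¹ *
            A.swap (p * x * A.bdL k) c))) * m * k' := by
        rw [e8, e6]
        simp only [map_mul, mul_assoc]
    _ = A.rightSec u ((A.swap x (A.rightE p c))⁻¹ * (A.rightSec (A.rightE (p * x) c)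
          (A.rightSec x (A.swap p z) * k) * A.swap (p * x * A.bdL k) c)) * m * k' := by
        rw [e9]
        simp only [mul_assoc, mul_inv_cancel_left]
    _ = _ := by
        rw [e10, mul_assoc (A.swap x _), inv_mul_cancel_left, map_mul, mul_assoc _ _ m, ← e6,
          ← rightSec_mul]
        simp only [mul_assoc]

/-- The action rule for quadratic derivations is stable under concatenation. -/
theorem concat_act_rule {p x z u c H p' x' z' p'' : E} {k m w k' Ω T Y : L}
    (hp' : p' = p * x * A.bdL k) (hx' : x' = u * A.bdL m) (hz' : z' = c * A.bdL w)
    (hp'' : p'' = p' * x' * A.bdL k')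
    (hT : A.rightSec z T = A.rightSec x (A.swap p z) * k * A.swap z (A.actE (A.bdE z) p'))
    (hY : A.rightSec z' Y
      = A.rightSec x' (A.swap p' z') * k' * A.swap z' (A.actE (A.bdE z') p''))
    (hΩ : A.rightSec c ((A.swap z H)⁻¹ * A.rightL z Ω) * w
      = A.rightSec u ((A.swap x (A.rightE p c))⁻¹ * A.rightL (p * x) w) * m)
    (hH : H * A.bdL Ω = A.actE (A.bdE z) (A.rightE p' z' * x' * z'⁻¹)) :
    A.rightSec (z * c) (Ω * A.rightSec (H * A.bdL Ω) T * A.actL (A.bdE z) Y)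
      = A.rightSec (x * u) (A.swap p (z * c)) * (m * A.rightSec x' k * k') *
        A.swap (z * c) (A.actE (A.bdE (z * c)) p'') := by
  -- Dictionary: `p, p', p''` are the values of `ψ, ψ', ψ''` at `a`; `x, x', u` those of `s, s', σ`
  -- at `∂a`; `z, z', c` those of `s, s', σ` at `g`; `k = t(a)`, `k' = t'(a)`, `m = ω(∂a)`, `w =
  -- ω(g)`. `H`, `Ω`, `T` are `σ(∂(g ▷ a))`, `ω(∂(g ▷ a))`, `t(g ▷ a)` moved by `φ(g)⁻¹`.
  obtain ⟨r, hr⟩ : ∃ r, r = A.rightE p' z' * x' * z'⁻¹ := ⟨_, rfl⟩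
  have hrz : r * z' = A.rightE (p * x) z' * x' := by
    rw [hr, hp', rightE_mul_bdL]; group
  rw [← hr] at hH
  -- Applying `δ` to `hY` identifies the target of the arrow `Y`, so that naturality can carry `Y`
  -- through the interchange past `z`.
  have hYb : p' * r * A.bdL Y = A.actE (A.bdE z') p'' := by
    have h1 := congrArg A.bdL hY
    have h2 := A.bdL_swap p' z'
    have h3 := A.bdL_swap z' (A.actE (A.bdE z') p'')
    have h4 : A.bdL (A.swap p' z') = (A.rightE p' z')⁻¹ * p'⁻¹ * (z' * p') := by
      rw [← h2]; group
    rw [rightE_actE] at h3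
    have h5 : A.bdL (A.swap z' (A.actE (A.bdE z') p''))
        = p''⁻¹ * z'⁻¹ * (A.actE (A.bdE z') p'' * z') := by
      rw [← h3]; group
    have h6 : A.bdL k' = x'⁻¹ * p'⁻¹ * p'' := by rw [hp'']; group
    rw [bdL_rightSec, map_mul, map_mul, bdL_rightSec, h4, h5, h6] at h1
    have h7 : A.bdL Y = z' * (z'⁻¹ * A.bdL Y * z') * z'⁻¹ := by group
    rw [h7, h1, hr]
    group
  have e1 : A.rightSec (z * c) Ω
      = A.rightSec u ((A.swap x (A.rightE p c))⁻¹ * A.rightL (p * x) w) * m * w⁻¹ *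
        A.rightSec c (A.swap z (A.actE (A.bdE z) r)) := by
    rw [← hΩ, ← hH, mul_assoc (_ * w), mul_assoc _ w, mul_inv_cancel_left, ← map_mul,
      mul_assoc, ← swap_mul_rightSec, inv_mul_cancel_left, rightSec_mul]
  have e2 : A.swap z (A.actE (A.bdE z) r) * A.rightSec z (A.rightSec (A.actE (A.bdE z) r) T)
      = A.rightSec r (A.rightSec z T) * A.swap z (A.actE (A.bdE z) r) := by
    rw [← rightSec_mul_swap, rightE_actE]
  have e3 : A.swap z (A.actE (A.bdE z) r) *
      A.rightSec z (A.rightSec (A.actE (A.bdE z) r) T * A.actL (A.bdE z) Y)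
      = A.rightSec r (A.rightSec x (A.swap p z) * k) * Y *
        A.swap z (A.actE (A.bdE z) (A.actE (A.bdE z') p'')) := by
    rw [map_mul, ← mul_assoc, e2, hT, map_mul, mul_assoc (A.rightSec r _),
      swap_act_mul_act, mul_assoc, swap_act_mul, hYb, mul_assoc]
  have e4 : ∀ Z, w⁻¹ * A.rightSec c Z = A.rightSec z' Z * w⁻¹ := by
    intro Z
    rw [inv_mul_eq_iff_eq_mul, hz', ← mul_assoc, mul_rightSec_bdL]
    group
  have e5 := A.swap_concat z c (A.actE (A.bdE z) (A.actE (A.bdE z') p'')) w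
  rw [rightE_actE, ← hz', rightE_mul, rightE_actE] at e5
  have hc : A.bdE c = A.bdE z' := by rw [hz', map_mul, A.bdE_bdL, mul_one]
  have hcc : A.rightE c (A.actE (A.bdE z') p'') = p'' := by rw [← hc, rightE_actE]
  rw [hcc] at e5
  have aux := A.concat_act_rule_aux p x z u c k m w k'
  rw [← hp', ← hx', ← hp'', ← hz', ← hrz] at aux
  have hzc : A.actE (A.bdE (z * c)) p'' = A.actE (A.bdE z) (A.actE (A.bdE z') p'') := by
    rw [map_mul A.bdE, hc, map_mul A.actE, MulAut.mul_apply]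
  rw [hH, hzc, mul_assoc Ω, map_mul, e1, A.rightSec_mul z c (_ * _), mul_assoc (_ * w⁻¹),
    ← map_mul (A.rightSec c), e3, mul_assoc _ w⁻¹, e4,
    map_mul (A.rightSec z'), map_mul (A.rightSec z'), hY, ← A.rightSec_mul r z',
    mul_assoc _ _ w⁻¹, ← aux]
  simp only [mul_assoc] at e5 ⊢
  rw [e5]

/-- The recursion for `ω` is compatible with exchanging a derivation and its inverse. -/
theorem inverse_omega_rule (X y : E) (M n : L) :
    A.rightSec (X * y) (A.rightSec y⁻¹ ((A.swap y X⁻¹)⁻¹ * A.rightL y M) * n)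
      = A.rightSec ((y⁻¹ * A.bdL n)⁻¹) ((A.swap (y⁻¹ * A.bdL n)
          (A.rightE y (X⁻¹ * A.bdL M)⁻¹))⁻¹ * A.rightSec X M) * A.rightSec y n := by
  -- For a product `g h`: `X` and `M` are `s(g)` and `ω(g)` moved by `φ(h)⁻¹`, while `y = s(h)` and
  -- `n = ω(h)`, with `ω = ω^{(s, s̄)}`. Since `s̄ = s⁻¹ δ(ω)`, `z⁻¹` is the moved `s̄(g)` and `y⁻¹
  -- δ(n)` is `s̄(h)`.
  obtain ⟨z, hz⟩ : ∃ z, z = (X⁻¹ * A.bdL M)⁻¹ := ⟨_, rfl⟩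
  have hzX : X * A.bdL (A.rightSec X M)⁻¹ = z := by
    rw [hz, map_inv, bdL_rightSec]; group
  have hzX' : z * A.bdL (A.rightSec X M) = X := by
    rw [← hzX, map_inv]; group
  have h1 : ∀ W, A.rightSec ((y⁻¹ * A.bdL n)⁻¹) W * A.rightSec y n
      = A.rightSec y (n * W) := by
    intro W
    have h : A.rightSec (A.bdL n)⁻¹ W = n * W * n⁻¹ := by
      rw [rightSec_def, inv_inv, sec_bdL]
    rw [mul_inv_rev, inv_inv, rightSec_mul, ← map_mul, h]
    group
  have h2 : n * (A.swap (y⁻¹ * A.bdL n) (A.rightE y z))⁻¹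
      = A.rightSec y⁻¹ (A.swap y z) * A.rightSec z n := by
    have h := A.swap_mul_eq y⁻¹ (A.rightE y z) n
    have h' := A.swap_mul_left y y⁻¹ z
    rw [mul_inv_cancel, swap_one_left] at h'
    rw [← rightE_mul, mul_inv_cancel, rightE_one] at h
    rw [eq_inv_of_mul_eq_one_right h'.symm, mul_inv_eq_iff_eq_mul, mul_assoc, ← h,
      inv_mul_cancel_left]
  have h3 : A.rightSec z n * A.rightSec X M = A.rightSec X M * A.rightSec X n := by
    rw [← mul_rightSec_target (h := hzX')]
  have h4 : A.swap y z * A.rightSec y (A.rightSec X M)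
      = A.rightSec (A.rightE y X) (A.rightL y M) * A.swap y X := by
    rw [swap_mul_rightSec, hzX', rightL_rightSec]
  have h5 : ∀ Q, A.swap y X * A.rightSec (X * y) (A.rightSec y⁻¹ Q)
      = A.rightSec (A.rightE y X) Q * A.swap y X := by
    intro Q
    rw [A.mul_rightSec_target (A.bdL_swap y X), ← rightSec_mul, inv_mul_cancel_left]
  have h6 : A.rightSec (A.rightE y X) (A.swap y X⁻¹)⁻¹ = A.swap y X := by
    have h := A.swap_mul_right y X⁻¹ X
    rw [inv_mul_cancel, swap_one_right] at h
    rw [map_inv, inv_eq_iff_mul_eq_one, h]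
  have h7 := h5 ((A.swap y X⁻¹)⁻¹ * A.rightL y M)
  rw [map_mul (A.rightSec (A.rightE y X)), h6, mul_assoc, mul_right_inj] at h7
  rw [h1, ← hz, ← mul_assoc n, h2, mul_assoc, h3, map_mul (A.rightSec y),
    rightSec_self_inv, map_mul (A.rightSec y), ← mul_assoc, h4, map_mul (A.rightSec (X * y)), h7,
    A.rightSec_mul X y n]

end Swap

/-! ### Derivations as group maps into a semidirect product. -/

section Derivation

variable {E' G' L' G ι : Type*} [Group L'] [Group E'] [Group G'] [Group G]
  (A' : TwoCrossedModule L' E' G')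

/-- `φ`-derivations `s : G → E'`. -/
def IsDerivation (φ : G →* G') (s : G → E') : Prop :=
  ∀ g h, s (g * h) = A'.actE (φ h)⁻¹ (s g) * s h

variable {A'} {φ : G →* G'} {s s₁ s₂ : G → E'}

/-- The group map `G → G' ⋉ E'` corresponding to a derivation. -/
def IsDerivation.toHom (hs : IsDerivation A' φ s) : G →* SDP A'.actE :=
  MonoidHom.mk' (fun g => ⟨φ g, s g⟩) (fun g h => by
    ext
    · exact map_mul φ g h
    · change s (g * h) = A'.actE (φ h)⁻¹ (s g) * s h
      exact hs g h)

theorem IsDerivation.map_one (hs : IsDerivation A' φ s) : s 1 = 1 :=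
  congrArg SDP.snd (_root_.map_one hs.toHom)

theorem IsDerivation.ext (b : FreeGroupBasis ι G) (h₁ : IsDerivation A' φ s₁)
    (h₂ : IsDerivation A' φ s₂) (h : ∀ i, s₁ (b i) = s₂ (b i)) : s₁ = s₂ := by
  have : h₁.toHom = h₂.toHom := b.ext_hom _ _ fun i => by
    ext
    · rfl
    · exact h i
  funext g
  exact congrArg SDP.snd (DFunLike.congr_fun this g)

theorem isDerivation_one (φ : G →* G') : IsDerivation A' φ (fun _ => 1) := by
  intro g h; simp

end Derivation

/-! ### Quadratic derivations, concatenation and inversion over a free group. -/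

section Concat

variable {L E G L' E' G' : Type*} [Group L] [Group E] [Group G] [Group L'] [Group E'] [Group G']
  {A : TwoCrossedModule L E G} {A' : TwoCrossedModule L' E' G'}

theorem IsQuadraticDerivation.isDerivation {f : Hom A A'} {s : G → E'} {t : E → L'}
    (h : IsQuadraticDerivation f s t) : IsDerivation A' f.φ s := h.map_s_mul

/-- Quadratic derivations in terms of interchange arrows. -/
theorem isQuadraticDerivation_iff {f : Hom A A'} {s : G → E'} {t : E → L'}
    (hs : IsDerivation A' f.φ s) :
    IsQuadraticDerivation f s t ↔
      (∀ a b, t (a * b) = A'.rightSec (s (A.bdE b)) (A'.swap (f.ψ b) (s (A.bdE a))) *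
        A'.rightSec (f.ψ b * s (A.bdE b)) (t a) * t b) ∧
      (∀ g a, A'.rightSec (s g) (A'.actL (f.φ g)⁻¹ (t (A.actE g a))) =
        A'.rightSec (s (A.bdE a)) (A'.swap (f.ψ a) (s g)) * t a *
          A'.swap (s g) (A'.actE (A'.bdE (s g)) (f.ψ a * s (A.bdE a) * A'.bdL (t a)))) := by
  have h1 : ∀ a b, A'.sec (f.ψ b * s (A.bdE b))⁻¹
      (A'.lift (f.ψ b) (A'.actE (f.φ (A.bdE b))⁻¹ (s (A.bdE a))⁻¹) * t a) * t b
      = A'.rightSec (s (A.bdE b)) (A'.swap (f.ψ b) (s (A.bdE a))) *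
        A'.rightSec (f.ψ b * s (A.bdE b)) (t a) * t b := by
    intro a b
    rw [swap, ← rightSec_mul, ← map_mul, rightE_def, f.bdE_ψ,
      ← map_inv (A'.actE _), rightSec_def]
  have h2 : ∀ g a, A'.actL (f.φ g) (A'.sec (s g * (s (A.bdE a))⁻¹)
          (A'.lift (f.ψ a)⁻¹ (s g)⁻¹)⁻¹)
      * A'.actL (f.φ g) (A'.lift (s g) ((s (A.bdE a))⁻¹ * (f.ψ a)⁻¹))
      * A'.actL (f.φ g * A'.bdE (s g)) (t a)
      = A'.actL (f.φ g) (A'.rightSec (s g)⁻¹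
        (A'.rightSec (s (A.bdE a)) (A'.swap (f.ψ a) (s g)) * t a *
          A'.swap (s g) (A'.actE (A'.bdE (s g)) (f.ψ a * s (A.bdE a) * A'.bdL (t a))))) := by
    intro g a
    have h3 : A'.lift (s g) ((s (A.bdE a))⁻¹ * (f.ψ a)⁻¹) = A'.rightSec (s g)⁻¹
        (A'.swap (s g) (A'.actE (A'.bdE (s g)) (f.ψ a * s (A.bdE a)))) := by
      rw [swap, rightSec_inv_self, rightE_actE, mul_inv_rev]
    -- Naturality extracts `δ(t a)` from the last interchange arrow, leaving the separate factor `t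
    -- a` of the original rule.
    rw [mul_assoc _ (t a), ← swap_act_mul, lift_inv_inv, inv_inv, h3, map_mul A'.actL,
      MulAut.mul_apply, ← map_mul, ← map_mul, sec_eq_rightSec, mul_inv_rev, inv_inv,
      rightSec_mul]
    simp only [map_mul, rightSec_inv_self, mul_assoc]
  constructor
  · intro h
    refine ⟨fun a b => by rw [h.map_t_mul, h1], fun g a => ?_⟩
    rw [h.map_t_act, h2, map_inv A'.actL, MulAut.inv_apply_self, rightSec_self_inv]
  · rintro ⟨hm, ha⟩
    refine ⟨hs, fun a b => by rw [hm, h1], fun g a => ?_⟩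
    rw [h2, ← ha, rightSec_inv_self, map_inv A'.actL, MulAut.apply_inv_self]

variable {ι : Type*} (b : FreeGroupBasis ι G)

theorem extendDerivation_isDerivation (f : Hom A A') (s₀ : ι → E') :
    IsDerivation A' f.φ (extendDerivation b f s₀) := by
  have h : ∀ g, (b.lift (fun i => (⟨f.φ (b i), s₀ i⟩ : SDP A'.actE)) g).fst = f.φ g := by
    have : (MonoidHom.mk' (fun u : SDP A'.actE => u.fst) (fun _ _ => rfl)).comp
        (b.lift (fun i => (⟨f.φ (b i), s₀ i⟩ : SDP A'.actE))) = f.φ :=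
      b.ext_hom _ _ fun i => by simp
    exact fun g => DFunLike.congr_fun this g
  intro g k
  rw [extendDerivation, map_mul, SDP.mul_snd, h]
  rfl

theorem extendDerivation_basis (f : Hom A A') (s₀ : ι → E') (i : ι) :
    extendDerivation b f s₀ (b i) = s₀ i := by
  simp [extendDerivation]

/-! ### The components `σ` and `ω` of the map to the triangle group. -/

section Triangle

variable {f : Hom A A'} {s s' : G → E'}

theorem triangleMap_basis (i : ι) :
    triangleMap b f s s' (b i) = ⟨⟨f.φ (b i), s (b i)⟩, ⟨s' (b i), 1⟩⟩ := by
  simp [triangleMap]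

theorem triangleMap_fst (hs : IsDerivation A' f.φ s) (g : G) :
    (triangleMap b f s s' g).fst = ⟨f.φ g, s g⟩ := by
  have : (MonoidHom.mk' (fun u : A'.Triangle₀ => u.fst) (fun _ _ => rfl)).comp
      (triangleMap b f s s') = hs.toHom :=
    b.ext_hom _ _ fun i => by
      rw [MonoidHom.comp_apply, triangleMap_basis]; rfl
  exact DFunLike.congr_fun this g

/-- The component of the group map `X` next to `ω`. -/
noncomputable def sigma (f : Hom A A') (s s' : G → E') : G → E' :=
  fun g => (triangleMap b f s s' g).snd.fst

theorem sigma_basis (i : ι) : sigma b f s s' (b i) = s' (b i) := by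
  simp [sigma, triangleMap_basis]

theorem omega_basis (i : ι) : omega b f s s' (b i) = 1 := by
  simp [omega, triangleMap_basis]

theorem omega_one : omega b f s s' 1 = 1 := by
  simp [omega]

theorem lifted_inv_apply (A' : TwoCrossedModule L' E' G') (g : G') (x : E') (v : SDP A'.secAct) :
    A'.lifted (⟨g, x⟩⁻¹ : SDP A'.actE) v =
      ⟨x⁻¹ * A'.actE g⁻¹ v.fst * x, (A'.swap x (A'.actE g⁻¹ v.fst))⁻¹ *
        A'.actL (g * A'.bdE x)⁻¹ v.snd⟩ := by
  change A'.liftedG g⁻¹ (A'.liftedE (A'.actE g x⁻¹) v) = _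
  rw [liftedG_liftedE, ← MulAut.mul_apply, ← map_mul, inv_mul_cancel, map_one, MulAut.one_apply]
  simp only [liftedE, liftedG, ← map_inv (A'.actE g⁻¹) v.fst]
  rw [map_inv (A'.actE g⁻¹) v.fst, lift_inv_inv, mul_inv_rev, map_inv A'.bdE, map_mul A'.actL,
    MulAut.mul_apply, inv_inv]

theorem sigma_mul (hs : IsDerivation A' f.φ s) (g h : G) :
    sigma b f s s' (g * h)
      = (s h)⁻¹ * A'.actE (f.φ h)⁻¹ (sigma b f s s' g) * s h * sigma b f s s' h := by
  rw [sigma, map_mul, SDP.mul_snd, triangleMap_fst b hs h, lifted_inv_apply]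
  rfl

theorem omega_mul (hs : IsDerivation A' f.φ s) (g h : G) :
    omega b f s s' (g * h)
      = A'.rightSec (sigma b f s s' h) ((A'.swap (s h) (A'.actE (f.φ h)⁻¹ (sigma b f s s' g)))⁻¹ *
          A'.actL (f.φ h * A'.bdE (s h))⁻¹ (omega b f s s' g)) * omega b f s s' h := by
  rw [omega, map_mul, SDP.mul_snd, triangleMap_fst b hs h, lifted_inv_apply]
  rfl

/-- `s ⊗ s' = s σ`. -/
theorem concatS_eq (hs : IsDerivation A' f.φ s) (g : G) :
    concatS b f s s' g = s g * sigma b f s s' g := by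
  -- By freeness it suffices that `s σ` is a derivation with the right values on the basis, where `σ
  -- = s'`.
  have h : IsDerivation A' f.φ (fun g => s g * sigma b f s s' g) := by
    intro g h
    simp only [sigma_mul b hs, hs g h, map_mul]
    group
  exact congrFun ((extendDerivation_isDerivation b f _).ext b h fun i => by
    rw [extendDerivation_basis, sigma_basis]) g

/-- `s' = σ (δ ω)`. -/
theorem sigma_mul_omega {φ' : G →* G'} (hs : IsDerivation A' f.φ s)
    (hs' : IsDerivation A' φ' s') (hφ : ∀ g, φ' g = f.φ g * A'.bdE (s g)) (g : G) :
    s' g = sigma b f s s' g * A'.bdL (omega b f s s' g) := by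
  -- The boundary of the interchange arrow in the recursion for `ω` turns the conjugation in the
  -- recursion for `σ` into the twist from `φ` to `φ'`.
  have h : IsDerivation A' φ' (fun g => sigma b f s s' g * A'.bdL (omega b f s s' g)) := by
    intro g h
    have h1 := A'.bdL_swap (s h) (A'.actE (f.φ h)⁻¹ (sigma b f s s' g))
    have h2 : A'.bdL (A'.swap (s h) (A'.actE (f.φ h)⁻¹ (sigma b f s s' g)))
        = (s h * A'.rightE (s h) (A'.actE (f.φ h)⁻¹ (sigma b f s s' g)))⁻¹ *
          (A'.actE (f.φ h)⁻¹ (sigma b f s s' g) * s h) := by rw [← h1]; group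
    have h3 : A'.actE (φ' h)⁻¹ (sigma b f s s' g)
        = A'.rightE (s h) (A'.actE (f.φ h)⁻¹ (sigma b f s s' g)) := by
      rw [hφ, mul_inv_rev, map_mul, MulAut.mul_apply, rightE_def]
    simp only [sigma_mul b hs, omega_mul b hs, map_mul, bdL_rightSec, map_inv A'.bdL, h2,
      ← hφ, bdL_act, h3]
    group
  exact congrFun (hs'.ext b h fun i => by
    rw [sigma_basis, omega_basis]; simp) g

end Triangle

/-! ### Concatenated and inverse homotopies. -/

section Homotopies

variable {f f' f'' : Hom A A'}

theorem Homotopy.isDerivation (H : Homotopy f f') : IsDerivation A' f.φ H.s :=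
  H.isQuadraticDerivation.isDerivation

theorem concatS_isDerivation (f : Hom A A') (s s' : G → E') :
    IsDerivation A' f.φ (concatS b f s s') := extendDerivation_isDerivation b f _

theorem concatT_eq (s s' : G → E') (t t' : E → L') (e : E) :
    concatT b f s s' t t' e
      = omega b f s s' (A.bdE e) * A'.rightSec (s' (A.bdE e)) (t e) * t' e := rfl

theorem concat_ψ_eq (H : Homotopy f f') {s' : G → E'} {t' : E → L'}
    (hs' : IsDerivation A' f'.φ s')
    (hψ : ∀ a, f''.ψ a = f'.ψ a * s' (A.bdE a) * A'.bdL (t' a)) (a : E) :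
    f''.ψ a = f.ψ a * concatS b f H.s s' (A.bdE a) *
      A'.bdL (concatT b f H.s s' H.t t' a) := by
  have h := sigma_mul_omega b H.isDerivation hs' H.φ_eq (A.bdE a)
  have h2 : A'.bdL (omega b f H.s s' (A.bdE a))
      = (sigma b f H.s s' (A.bdE a))⁻¹ * s' (A.bdE a) := by rw [h]; group
  rw [hψ, H.ψ_eq, concatS_eq b H.isDerivation, concatT_eq, map_mul, map_mul, bdL_rightSec, h2]
  group

/-- `concat_mul_rule` rewrites the expected value so that both sides begin with the same `ω` and `t`
factors; cancelling them leaves the rule for `t'`. -/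
theorem concat_mul_iff (H : Homotopy f f') {s' : G → E'} {t' : E → L'}
    (hs' : IsDerivation A' f'.φ s') (a₁ a₂ : E) :
    concatT b f H.s s' H.t t' (a₁ * a₂) =
        A'.rightSec (concatS b f H.s s' (A.bdE a₂))
          (A'.swap (f.ψ a₂) (concatS b f H.s s' (A.bdE a₁))) *
        A'.rightSec (f.ψ a₂ * concatS b f H.s s' (A.bdE a₂)) (concatT b f H.s s' H.t t' a₁) *
        concatT b f H.s s' H.t t' a₂ ↔
      t' (a₁ * a₂) = A'.rightSec (s' (A.bdE a₂)) (A'.swap (f'.ψ a₂) (s' (A.bdE a₁))) *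
        A'.rightSec (f'.ψ a₂ * s' (A.bdE a₂)) (t' a₁) * t' a₂ := by
  have hs := H.isDerivation
  have hσ := sigma_mul_omega b hs hs' H.φ_eq
  have hq : A'.actE (f'.φ (A.bdE a₂))⁻¹ (s' (A.bdE a₁))
      = A'.rightE (f.ψ a₂ * H.s (A.bdE a₂)) (s' (A.bdE a₁)) := by
    rw [rightE_def, map_mul, f.bdE_ψ, H.φ_eq]
  have hω := omega_mul b (s' := s') hs (A.bdE a₁) (A.bdE a₂)
  rw [← f.bdE_ψ, ← map_mul A'.bdE, ← rightL_def, ← rightE_def] at hω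
  have key := A'.concat_mul_rule (f.ψ a₂) (H.s (A.bdE a₂)) (H.s (A.bdE a₁))
    (sigma b f H.s s' (A.bdE a₁)) (sigma b f H.s s' (A.bdE a₂)) (H.t a₁) (H.t a₂)
    (omega b f H.s s' (A.bdE a₁)) (omega b f H.s s' (A.bdE a₂)) (t' a₁) (t' a₂)
  rw [← hσ, ← hσ, ← H.ψ_eq, ← hω, ← ((isQuadraticDerivation_iff hs).1 H.isQuadraticDerivation).1,
    ← concatS_eq b hs, ← concatS_eq b hs, ← hq, ← hs', ← map_mul, ← concatT_eq, ← concatT_eq] at key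
  rw [← key, concatT_eq, mul_right_inj]

theorem concat_act_iff (H : Homotopy f f') {s' : G → E'} {t' : E → L'}
    (hs' : IsDerivation A' f'.φ s')
    (hψ : ∀ a, f''.ψ a = f'.ψ a * s' (A.bdE a) * A'.bdL (t' a)) (g : G) (a : E) :
    A'.rightSec (concatS b f H.s s' g)
        (A'.actL (f.φ g)⁻¹ (concatT b f H.s s' H.t t' (A.actE g a))) =
      A'.rightSec (concatS b f H.s s' (A.bdE a)) (A'.swap (f.ψ a) (concatS b f H.s s' g)) *
        concatT b f H.s s' H.t t' a *
        A'.swap (concatS b f H.s s' g) (A'.actE (A'.bdE (concatS b f H.s s' g))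
          (f.ψ a * concatS b f H.s s' (A.bdE a) * A'.bdL (concatT b f H.s s' H.t t' a))) ↔
    A'.rightSec (s' g) (A'.actL (f'.φ g)⁻¹ (t' (A.actE g a))) =
        A'.rightSec (s' (A.bdE a)) (A'.swap (f'.ψ a) (s' g)) * t' a *
          A'.swap (s' g) (A'.actE (A'.bdE (s' g)) (f'.ψ a * s' (A.bdE a) * A'.bdL (t' a))) := by
  have hs := H.isDerivation
  have hσ := sigma_mul_omega b hs hs' H.φ_eq
  rw [← concat_ψ_eq b H hs' hψ, ← hψ]
  -- `Y` is the value that the action rule would force on `φ'(g)⁻¹ ▷ t'(g ▷ a)`. The path identity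
  -- holds for this `Y`, and comparison with the actual value gives both implications.
  obtain ⟨Y, hY⟩ : ∃ Y, A'.rightSec (s' g) Y = A'.rightSec (s' (A.bdE a))
      (A'.swap (f'.ψ a) (s' g)) * t' a *
        A'.swap (s' g) (A'.actE (A'.bdE (s' g)) (f''.ψ a)) := ⟨_, rightSec_self_inv _ _ _⟩
  have hT := ((isQuadraticDerivation_iff hs).1 H.isQuadraticDerivation).2 g a
  rw [← H.ψ_eq] at hT
  -- Evaluating `ω` and `s'` on the two sides of this equation relates their values at `∂(g ▷ a)` to
  -- those at `g` and `∂a`.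
  have hga : A.bdE (A.actE g a) * g = g * A.bdE a := by rw [A.bdE_act]; group
  have hΩ := omega_mul b (s' := s') hs (A.bdE (A.actE g a)) g
  rw [hga, omega_mul b hs] at hΩ
  have hs'' : A'.actE (f.φ g)⁻¹ (s' (A.bdE (A.actE g a)))
      = A'.actE (A'.bdE (H.s g)) (A'.rightE (f'.ψ a) (s' g) * s' (A.bdE a) * (s' g)⁻¹) := by
    have h := hs' (A.bdE (A.actE g a)) g
    rw [hga, hs', ← f'.bdE_ψ, ← rightE_def, ← mul_inv_eq_iff_eq_mul] at h
    rw [h, H.φ_eq, mul_inv_rev, map_mul A'.actE, MulAut.mul_apply, map_inv A'.actE (A'.bdE _),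
      MulAut.apply_inv_self]
  have hH : A'.actE (f.φ g)⁻¹ (sigma b f H.s s' (A.bdE (A.actE g a))) *
      A'.bdL (A'.actL (f.φ g)⁻¹ (omega b f H.s s' (A.bdE (A.actE g a))))
      = A'.actE (f.φ g)⁻¹ (s' (A.bdE (A.actE g a))) := by
    rw [hσ, map_mul, A'.bdL_act]
  have key := A'.concat_act_rule (H.ψ_eq a) (hσ (A.bdE a)) (hσ g) (hψ a) hT hY
    (H := A'.actE (f.φ g)⁻¹ (sigma b f H.s s' (A.bdE (A.actE g a))))
    (Ω := A'.actL (f.φ g)⁻¹ (omega b f H.s s' (A.bdE (A.actE g a))))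
    (by
      rw [rightL_def, ← MulAut.mul_apply, ← map_mul, ← mul_inv_rev, ← hΩ, rightE_def, rightL_def,
        map_mul A'.bdE, f.bdE_ψ])
    (hH.trans hs'')
  rw [hH, ← concatS_eq b hs, ← concatS_eq b hs, ← concatT_eq] at key
  have hτ : A'.actL (f.φ g)⁻¹ (concatT b f H.s s' H.t t' (A.actE g a))
      = A'.actL (f.φ g)⁻¹ (omega b f H.s s' (A.bdE (A.actE g a))) *
        A'.rightSec (A'.actE (f.φ g)⁻¹ (s' (A.bdE (A.actE g a))))
          (A'.actL (f.φ g)⁻¹ (H.t (A.actE g a))) *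
        A'.actL (A'.bdE (H.s g)) (A'.actL (f'.φ g)⁻¹ (t' (A.actE g a))) := by
    rw [concatT_eq, map_mul, map_mul, rightSec_def, act_sec, rightSec_def, map_inv (A'.actE _),
      H.φ_eq, mul_inv_rev, map_mul A'.actL, MulAut.mul_apply, map_inv A'.actL (A'.bdE _),
      MulAut.apply_inv_self]
  rw [← key, ← hY, hτ, (A'.rightSec _).injective.eq_iff, mul_right_inj,
    (A'.actL _).injective.eq_iff, (A'.rightSec _).injective.eq_iff]

/-- Given a homotopy `(s, t)` from `f` to `f'`, the pair `(s ⊗ s', t ⊗ t')` is a quadratic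
`f`-derivation if and only if `(s', t')` is a quadratic `f'`-derivation. -/
theorem isQuadraticDerivation_concat_iff (H : Homotopy f f') {s' : G → E'} {t' : E → L'}
    (hs' : IsDerivation A' f'.φ s')
    (hψ : ∀ a, f''.ψ a = f'.ψ a * s' (A.bdE a) * A'.bdL (t' a)) :
    IsQuadraticDerivation f (concatS b f H.s s') (concatT b f H.s s' H.t t') ↔
      IsQuadraticDerivation f' s' t' := by
  rw [isQuadraticDerivation_iff (concatS_isDerivation b f _ _), isQuadraticDerivation_iff hs']
  exact and_congr (forall₂_congr fun a₁ a₂ => concat_mul_iff b H hs' a₁ a₂)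
    (forall₂_congr fun g a => concat_act_iff b H hs' hψ g a)

theorem isQuadraticDerivation_one (f : Hom A A') :
    IsQuadraticDerivation f (fun _ => 1) (fun _ => 1) := by
  rw [isQuadraticDerivation_iff (isDerivation_one _)]
  constructor
  · intros; simp [swap_one_right]
  · intros; simp [swap_one_right, swap_one_left]

/-- The concatenation of homotopies. -/
noncomputable def Homotopy.concat (H : Homotopy f f') (H' : Homotopy f' f'') :
    Homotopy f f'' where
  s := concatS b f H.s H'.s
  t := concatT b f H.s H'.s H.t H'.t
  isQuadraticDerivation :=
    (isQuadraticDerivation_concat_iff b H H'.isDerivation H'.ψ_eq).2 H'.isQuadraticDerivation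
  μ_eq l := by
    rw [H'.μ_eq, H.μ_eq, concatT_eq, A.bdE_bdL, omega_one, H'.isDerivation.map_one,
      rightSec_one, one_mul, mul_assoc]
  ψ_eq := concat_ψ_eq b H H'.isDerivation H'.ψ_eq
  φ_eq g := by
    have h := sigma_mul_omega b H.isDerivation H'.isDerivation H.φ_eq g
    rw [H'.φ_eq, H.φ_eq, h, concatS_eq b H.isDerivation]
    simp [A'.bdE_bdL, mul_assoc]

theorem invS_isDerivation (f' : Hom A A') (s : G → E') : IsDerivation A' f'.φ (invS b f' s) :=
  extendDerivation_isDerivation b f' _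

theorem invS_basis (f' : Hom A A') (s : G → E') (i : ι) : invS b f' s (b i) = (s (b i))⁻¹ :=
  extendDerivation_basis b f' _ i

theorem concatS_eq_one (f : Hom A A') (s s' : G → E') (h : ∀ i, s (b i) * s' (b i) = 1) :
    concatS b f s s' = fun _ => 1 :=
  (concatS_isDerivation b f s s').ext b (isDerivation_one _) fun i => by
    rw [concatS, extendDerivation_basis, h]

theorem concatS_invS (H : Homotopy f f') :
    concatS b f H.s (invS b f' H.s) = fun _ => 1 :=
  concatS_eq_one b f _ _ fun i => by rw [invS_basis, mul_inv_cancel]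

theorem sigma_invS (H : Homotopy f f') (g : G) :
    sigma b f H.s (invS b f' H.s) g = (H.s g)⁻¹ := by
  have h := congrFun (concatS_invS b H) g
  rw [concatS_eq b H.isDerivation] at h
  exact eq_inv_of_mul_eq_one_right h

theorem invS_eq (H : Homotopy f f') (g : G) :
    invS b f' H.s g = (H.s g)⁻¹ * A'.bdL (omega b f H.s (invS b f' H.s) g) := by
  conv_lhs => rw [sigma_mul_omega b H.isDerivation (invS_isDerivation b f' H.s) H.φ_eq g,
    sigma_invS]

theorem invT_eq (H : Homotopy f f') (e : E) :
    invT b f f' H.s H.t e = (omega b f H.s (invS b f' H.s) (A.bdE e))⁻¹ *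
      A'.rightSec (H.s (A.bdE e))⁻¹ (H.t e)⁻¹ := by
  rw [invT, sec_eq_rightSec]

theorem concatT_invT (H : Homotopy f f') :
    concatT b f H.s (invS b f' H.s) H.t (invT b f f' H.s H.t) = fun _ => 1 := by
  funext e
  rw [concatT_eq, invT_eq, invS_eq, mul_rightSec_bdL, map_inv]
  group

theorem inv_ψ_eq (H : Homotopy f f') (a : E) :
    f.ψ a = f'.ψ a * invS b f' H.s (A.bdE a) * A'.bdL (invT b f f' H.s H.t a) := by
  rw [invT_eq, invS_eq, H.ψ_eq, map_mul, bdL_rightSec, map_inv, map_inv]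
  group

/-- The inverse homotopy. -/
noncomputable def Homotopy.bar (H : Homotopy f f') : Homotopy f' f where
  s := invS b f' H.s
  t := invT b f f' H.s H.t
  isQuadraticDerivation := by
    -- The equivalence is used backwards: `(s ⊗ s̄, t ⊗ t̄)` is the trivial pair, which is a
    -- quadratic derivation.
    rw [← isQuadraticDerivation_concat_iff b H (invS_isDerivation b f' H.s) (inv_ψ_eq b H),
      concatT_invT, concatS_invS]
    exact isQuadraticDerivation_one f
  μ_eq l := by
    rw [invT_eq, A.bdE_bdL, omega_one, H.isDerivation.map_one, H.μ_eq, inv_one, inv_one,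
      rightSec_one]
    group
  ψ_eq := inv_ψ_eq b H
  φ_eq g := by
    rw [invS_eq, H.φ_eq]
    simp [A'.bdE_bdL]

/-- The proposed values are assembled into a group map `X` to the triangle group, multiplicative by
`inverse_omega_rule`. It agrees with the defining map on the basis, hence everywhere. -/
theorem omega_invS_swap (H : Homotopy f f') (g : G) :
    omega b f' (invS b f' H.s) H.s g
      = A'.rightSec (H.s g) (omega b f H.s (invS b f' H.s) g) := by
  have hbar := invS_isDerivation b f' H.s
  have hφ := (H.bar b).φ_eq
  let X : G →* A'.Triangle₀ := MonoidHom.mk' (fun g => ⟨⟨f'.φ g, invS b f' H.s g⟩,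
      ⟨(invS b f' H.s g)⁻¹, A'.rightSec (H.s g) (omega b f H.s (invS b f' H.s) g)⟩⟩) (by
    intro g h
    refine SDP.ext (SDP.ext (map_mul f'.φ g h) (hbar g h)) ?_
    rw [SDP.mul_snd, lifted_inv_apply]
    refine SDP.ext ?_ ?_
    · simp only [SDP.mul_fst, hbar g h, map_inv]
      group
    · have key := A'.inverse_omega_rule (A'.actE (f.φ h)⁻¹ (H.s g)) (H.s h)
        (A'.actL (f.φ h)⁻¹ (omega b f H.s (invS b f' H.s) g)) (omega b f H.s (invS b f' H.s) h)
      have hω := omega_mul b (s' := invS b f' H.s) H.isDerivation g h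
      have h1 : A'.rightE (H.s h) ((A'.actE (f.φ h)⁻¹ (H.s g))⁻¹ *
          A'.bdL (A'.actL (f.φ h)⁻¹ (omega b f H.s (invS b f' H.s) g)))⁻¹
          = A'.actE (f'.φ h)⁻¹ (invS b f' H.s g)⁻¹ := by
        rw [A'.bdL_act, ← map_inv (A'.actE _), ← map_mul, ← map_inv (A'.actE _), ← invS_eq,
          H.φ_eq, mul_inv_rev, map_mul A'.actE]
        rfl
      have h2 : A'.rightSec (A'.actE (f.φ h)⁻¹ (H.s g))
          (A'.actL (f.φ h)⁻¹ (omega b f H.s (invS b f' H.s) g))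
          = A'.actL (f'.φ h * A'.bdE (invS b f' H.s h))⁻¹
            (A'.rightSec (H.s g) (omega b f H.s (invS b f' H.s) g)) := by
        have h3 : f.φ h = f'.φ h * A'.bdE (invS b f' H.s h) := hφ h
        rw [← h3, rightSec_def, rightSec_def, A'.act_sec, map_inv (A'.actE _)]
      rw [sigma_invS, sigma_invS, mul_inv_rev, map_mul A'.actL, MulAut.mul_apply, ← rightL_def,
        map_inv (A'.actE _)] at hω
      rw [← hω, ← H.isDerivation, h1, ← invS_eq] at key
      change A'.rightSec (H.s (g * h)) (omega b f H.s (invS b f' H.s) (g * h)) = _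
      rw [key, h2]
      rfl)
  have hX : triangleMap b f' (invS b f' H.s) H.s = X := b.ext_hom _ _ fun i => by
    rw [triangleMap_basis]
    change _ = (⟨⟨f'.φ (b i), invS b f' H.s (b i)⟩, ⟨(invS b f' H.s (b i))⁻¹,
      A'.rightSec (H.s (b i)) (omega b f H.s (invS b f' H.s) (b i))⟩⟩ : A'.Triangle₀)
    rw [invS_basis, inv_inv, omega_basis, map_one]
  exact congrArg (fun F : G →* A'.Triangle₀ => (F g).snd.snd) hX

theorem Homotopy.isInverse_bar (H : Homotopy f f') : IsInverse b H (H.bar b) := by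
  refine ⟨⟨concatS_invS b H, concatT_invT b H⟩,
    concatS_eq_one b f' _ _ fun i => ?_, funext fun e => ?_⟩
  · change invS b f' H.s (b i) * _ = 1
    rw [invS_basis, inv_mul_cancel]
  · change concatT b f' (invS b f' H.s) H.s (invT b f f' H.s H.t) H.t e = 1
    rw [concatT_eq, omega_invS_swap, invT_eq, ← map_mul, mul_inv_cancel_left, rightSec_self_inv,
      inv_mul_cancel]

end Homotopies

end Concat

/-! ### The value of `ω` on a relator, which is the source of `Θ`. -/

section Omega

variable {L E G L' E' G' : Type*} [Group L] [Group E] [Group G] [Group L'] [Group E'] [Group G']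
  {A : TwoCrossedModule L E G} {A' : TwoCrossedModule L' E' G'}
  {ι : Type*} (b : FreeGroupBasis ι G) {f f' : Hom A A'} {s' : G → E'}

theorem triangleMap_basis_inv_snd {s : G → E'} (i : ι) :
    (triangleMap b f s s' (b i)⁻¹).snd =
      ⟨A'.actE (f.φ (b i)) (s (b i) * s' (b i) * (s (b i))⁻¹)⁻¹,
        A'.actL (f.φ (b i)) (A'.lift (s (b i)) (s' (b i)))⟩ := by
  rw [map_inv, triangleMap_basis, SDP.inv_snd]
  have h : ((⟨s' (b i), 1⟩ : SDP A'.secAct)⁻¹) = ⟨(s' (b i))⁻¹, 1⟩ := by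
    ext
    · rfl
    · rw [SDP.inv_snd, inv_one, map_one]
  rw [h]
  refine SDP.ext ?_ ?_
  · change A'.actE _ (_ * _ * _) = _
    rw [mul_inv_rev, mul_inv_rev, inv_inv, mul_assoc]
  · change A'.actL _ (A'.lift _ _⁻¹ * A'.actL _ 1) = _
    rw [inv_inv, map_one, mul_one]

theorem omega_relator (H : Homotopy f f') (hs' : IsDerivation A' f'.φ s') (i j k : ι) :
    omega b f H.s s' ((b i)⁻¹ * b j * b k) =
      A'.rightSec (s' (b k))
        (A'.lift (H.s (b k))⁻¹ (A'.actE (f.φ (b k))⁻¹ (s' (b j))⁻¹)) *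
      A'.rightSec (s' (b j * b k))
        (A'.lift (H.s (b j * b k))⁻¹ (A'.actE ((f.φ (b j * b k))⁻¹ * f.φ (b i))
            (H.s (b i) * s' (b i) * (H.s (b i))⁻¹)) *
          A'.actL ((f'.φ (b j * b k))⁻¹ * f.φ (b i)) (A'.lift (H.s (b i)) (s' (b i)))) := by
  have hs := H.isDerivation
  have h1 : omega b f H.s s' (b j * b k) = A'.rightSec (s' (b k))
        (A'.lift (H.s (b k))⁻¹ (A'.actE (f.φ (b k))⁻¹ (s' (b j))⁻¹)) := by
    rw [omega_mul b hs, omega_basis, omega_basis, sigma_basis, sigma_basis, map_one, mul_one,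
      mul_one, ← lift_inv_inv, map_inv (A'.actE _)]
  have hi := triangleMap_basis_inv_snd (f := f) (s := H.s) (s' := s') b i
  have hσ : sigma b f H.s s' (b i)⁻¹ = _ := congrArg SDP.fst hi
  have hω : omega b f H.s s' (b i)⁻¹ = _ := congrArg SDP.snd hi
  -- The interchange law moves `ω(b_j b_k)` to the front and turns whiskering by `σ` into whiskering
  -- by `σ δ(ω) = s'`.
  rw [mul_assoc, omega_mul b hs, ← H.φ_eq, hσ, hω, ← mul_rightSec_bdL,
    ← sigma_mul_omega b hs hs' H.φ_eq, h1, ← lift_inv_inv]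
  simp only [map_mul A'.actE, map_mul A'.actL, MulAut.mul_apply,
    map_inv (A'.actE (f.φ (b i))), map_inv (A'.actE (f.φ (b j * b k))⁻¹), inv_inv]

end Omega

/-- The relators make `g ↦ [g] N` multiplicative, so the quotient map by `N` factors through `p`. -/
theorem ker_freeProj_le {G : Type*} [Group G] (N : Subgroup (FreeGroup G)) [N.Normal]
    (hN : ∀ g h : G, (FreeGroup.of (g * h))⁻¹ * FreeGroup.of g * FreeGroup.of h ∈ N) :
    (freeProj G).ker ≤ N := by
  let q : G →* FreeGroup G ⧸ N := MonoidHom.mk' (fun g => QuotientGroup.mk (FreeGroup.of g)) (by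
    intro g h
    rw [← QuotientGroup.mk_mul, QuotientGroup.eq, ← mul_assoc]
    exact hN g h)
  have hq : q.comp (freeProj G) = QuotientGroup.mk' N := by
    ext g
    simp [freeProj, q]
  intro v hv
  rw [← QuotientGroup.eq_one_iff]
  change QuotientGroup.mk' N v = 1
  rw [← hq, MonoidHom.comp_apply, MonoidHom.mem_ker.1 hv, map_one]

/-! ### Components of lax homotopies: uniqueness and explicit formulas. -/

section LaxUnique

variable {L E G L' E' G' : Type*} [Group L] [Group E] [Group G] [Group L'] [Group E'] [Group G']
  {A : TwoCrossedModule L E G} {A' : TwoCrossedModule L' E' G'}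

theorem IsQuadraticDerivation.map_t_one {f : Hom A A'} {s : G → E'} {t : E → L'}
    (h : IsQuadraticDerivation f s t) : t 1 = 1 := by
  have h1 := ((isQuadraticDerivation_iff h.isDerivation).1 h).1 1 1
  rw [map_one, map_one, h.isDerivation.map_one, swap_one_left, one_mul, one_mul, map_one, one_mul,
    rightSec_one] at h1
  simpa using h1

/-- The subgroup on which two quadratic derivations with the same first component agree. -/
def eqSubgroup {f : Hom A A'} {s : G → E'} {t₁ t₂ : E → L'}
    (h₁ : IsQuadraticDerivation f s t₁) (h₂ : IsQuadraticDerivation f s t₂) : Subgroup E where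
  carrier := {a | t₁ a = t₂ a}
  one_mem' := h₁.map_t_one.trans h₂.map_t_one.symm
  mul_mem' := by
    intro a b ha hb
    change t₁ a = t₂ a at ha
    change t₁ b = t₂ b at hb
    change t₁ (a * b) = t₂ (a * b)
    rw [h₁.map_t_mul, h₂.map_t_mul, ha, hb]
  inv_mem' := by
    intro a ha
    change t₁ a = t₂ a at ha
    have e₁ := h₁.map_t_mul a a⁻¹
    have e₂ := h₂.map_t_mul a a⁻¹
    rw [mul_inv_cancel, h₁.map_t_one] at e₁
    rw [mul_inv_cancel, h₂.map_t_one, e₁, ha] at e₂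
    exact mul_left_cancel e₂

theorem actE_mem_eqSubgroup {f : Hom A A'} {s : G → E'} {t₁ t₂ : E → L'}
    (h₁ : IsQuadraticDerivation f s t₁) (h₂ : IsQuadraticDerivation f s t₂) (g : G) {a : E}
    (ha : a ∈ eqSubgroup h₁ h₂) : A.actE g a ∈ eqSubgroup h₁ h₂ := by
  change t₁ a = t₂ a at ha
  change t₁ _ = t₂ _
  rw [h₁.map_t_act, h₂.map_t_act, ha]

variable {f f' f'' : Hom A A'}

/-- A subgroup of `E ×_G F(G)` stable under `F(G)` that contains the elements `(e, [∂ e])` and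
`(1, [gh]⁻¹ [g] [h])` is everything. -/
theorem mem_of_generators (S : Subgroup A.pull) (hact : ∀ u x, x ∈ S → A.pullAct u x ∈ S)
    (hE : ∀ e, A.genE e ∈ S) (hpair : ∀ g h, A.genPair g h ∈ S) (x : A.pull) : x ∈ S := by
  -- Elements of `S` of the form `(1, u)`. Stability of `S` makes their image `N` in `F(G)` normal,
  -- and `N` contains the relators, hence all of `ker p`.
  let T : Subgroup A.pull := S ⊓ ((MonoidHom.fst E (FreeGroup G)).comp A.pull.subtype).ker
  have hT : ∀ y : A.pull, y ∈ T ↔ y ∈ S ∧ y.1.1 = 1 := fun y => Iff.rfl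
  let N : Subgroup (FreeGroup G) := T.map A.Q1.bdE
  have : N.Normal := ⟨by
    rintro _ ⟨y, hy, rfl⟩ u
    have hy' := (hT y).1 hy
    refine ⟨A.pullAct u y, (hT _).2 ⟨hact u y hy'.1, ?_⟩, rfl⟩
    change A.actE _ y.1.1 = 1
    rw [hy'.2, map_one]⟩
  have hle : (freeProj G).ker ≤ N :=
    ker_freeProj_le N fun g h => ⟨A.genPair g h, (hT _).2 ⟨hpair g h, rfl⟩, rfl⟩
  have hx := (A.mem_pull _).1 x.2
  obtain ⟨y, hy, hyx⟩ := hle (x := (FreeGroup.of (A.bdE x.1.1))⁻¹ * x.1.2) (by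
    rw [MonoidHom.mem_ker, map_mul, map_inv, ← hx]
    simp [freeProj])
  have hy' := (hT y).1 hy
  change y.1.2 = _ at hyx
  have : x = A.genE x.1.1 * y := by
    apply Subtype.ext
    refine Prod.ext ?_ ?_
    · change x.1.1 = x.1.1 * y.1.1
      rw [hy'.2, mul_one]
    · change x.1.2 = FreeGroup.of (A.bdE x.1.1) * y.1.2
      rw [hyx, mul_inv_cancel_left]
  rw [this]
  exact S.mul_mem (hE _) hy'.1

/-- A lax homotopy is determined by its components. -/
theorem laxHomotopy_ext {K H : LaxHomotopy f f'} (hs : ∀ g, K.sHat g = H.sHat g)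
    (ht : ∀ e, K.tHat e = H.tHat e) (hp : ∀ g h, K.piHat g h = H.piHat g h) : K = H := by
  have hKs : K.s = H.s := K.isDerivation.ext (stdBasis G) H.isDerivation hs
  have h₁ := K.isQuadraticDerivation
  rw [hKs] at h₁
  refine Homotopy.ext hKs (funext fun x => ?_)
  exact mem_of_generators (eqSubgroup h₁ H.isQuadraticDerivation)
    (fun u y hy => actE_mem_eqSubgroup h₁ H.isQuadraticDerivation u hy) ht hp x

theorem hasUniqueForm_of_components (H : LaxHomotopy f f') {s₀ : G → E'} {t₀ : E → L'}
    {P₀ : G → G → L'} (hs : ∀ g, H.sHat g = s₀ g) (ht : ∀ e, H.tHat e = t₀ e)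
    (hp : ∀ g h, H.piHat g h = P₀ g h) : HasUniqueForm H s₀ t₀ P₀ :=
  ⟨⟨hs, ht, hp⟩, fun _ ks kt kp => laxHomotopy_ext (fun g => (ks g).trans (hs g).symm)
    (fun e => (kt e).trans (ht e).symm) (fun g h => (kp g h).trans (hp g h).symm)⟩

theorem omega_genPair (H : LaxHomotopy f f') {s' : FreeGroup G → E'}
    (hs' : IsDerivation A' (f'.comp A.proj).φ s') (g h : G) :
    omega (stdBasis G) (f.comp A.proj) H.s s' (A.Q1.bdE (A.genPair g h))
      = theta A' f.φ f'.φ H.sHat (fun x => s' (FreeGroup.of x)) (g * h) g h := by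
  have hφ : ∀ (k : Hom A A') (x : G), (k.comp A.proj).φ (FreeGroup.of x) = k.φ x := by
    intro k x
    change k.φ (freeProj G (FreeGroup.of x)) = _
    simp [freeProj]
  have key := omega_relator (stdBasis G) H hs' (g * h) g h
  change omega (stdBasis G) (f.comp A.proj) H.s s'
    ((FreeGroup.of (g * h))⁻¹ * FreeGroup.of g * FreeGroup.of h) = _ at key
  change omega (stdBasis G) (f.comp A.proj) H.s s'
    ((FreeGroup.of (g * h))⁻¹ * FreeGroup.of g * FreeGroup.of h) = _
  have hb : ∀ x, stdBasis G x = FreeGroup.of x := fun _ => rfl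
  rw [key]
  simp only [hb, hs' (FreeGroup.of g), H.isDerivation (FreeGroup.of g), map_mul _ (FreeGroup.of g),
    hφ, ← map_mul f.φ, ← map_mul f'.φ]
  rfl

/-- Both morphisms send `(1, [gh]⁻¹[g][h])` to `1`, so the homotopy equation for `ψ` reduces to `s
δ(t) = 1`. -/
theorem s_bdE_genPair (H : LaxHomotopy f f') (g h : G) :
    H.s (A.Q1.bdE (A.genPair g h)) = A'.bdL (H.piHat g h)⁻¹ := by
  have hψ := H.ψ_eq (A.genPair g h)
  have h1 : ∀ k : Hom A A', (k.comp A.proj).ψ (A.genPair g h) = 1 := fun k => map_one k.ψ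
  rw [h1, h1, one_mul] at hψ
  rw [map_inv]
  exact eq_inv_of_mul_eq_one_left hψ.symm

theorem concat_hasUniqueForm (H : LaxHomotopy f f') (H' : LaxHomotopy f' f'') :
    HasUniqueForm (f := f) (f' := f'') (H.concat (stdBasis G) H')
      (fun g => H.sHat g * H'.sHat g)
      (fun e => A'.sec (H'.sHat (A.bdE e))⁻¹ (H.tHat e) * H'.tHat e)
      (fun g h => theta A' f.φ f'.φ H.sHat H'.sHat (g * h) g h * H'.piHat g h * H.piHat g h) := by
  refine hasUniqueForm_of_components _ (fun g => ?_) (fun e => ?_) (fun g h => ?_)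
  · exact extendDerivation_basis (stdBasis G) (f.comp A.proj)
      (fun x => H.s (stdBasis G x) * H'.s (stdBasis G x)) g
  · change concatT (stdBasis G) (f.comp A.proj) H.s H'.s H.t H'.t (A.genE e) = _
    have h1 : omega (stdBasis G) (f.comp A.proj) H.s H'.s (A.Q1.bdE (A.genE e)) = 1 :=
      omega_basis (stdBasis G) (A.bdE e)
    rw [concatT_eq, h1, one_mul]
    rfl
  · change concatT (stdBasis G) (f.comp A.proj) H.s H'.s H.t H'.t (A.genPair g h) = _
    -- Whiskering by `s' = δ(Π')⁻¹` conjugates `Π` by `Π'`; the final factor `Π'` then cancels,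
    -- which explains the order `Π' Π`.
    rw [concatT_eq, omega_genPair H H'.isDerivation, s_bdE_genPair, rightSec_def, ← map_inv,
      inv_inv, sec_bdL]
    change _ * (H'.piHat g h * H.piHat g h * (H'.piHat g h)⁻¹) * H'.piHat g h = _
    simp only [mul_assoc, inv_mul_cancel, mul_one]
    rfl

theorem bar_hasUniqueForm (H : LaxHomotopy f f') :
    HasUniqueForm (f := f') (f' := f) (H.bar (stdBasis G))
      (fun g => (H.sHat g)⁻¹)
      (fun e => A'.sec (H.sHat (A.bdE e)) (H.tHat e)⁻¹)
      (fun g h => (theta A' f.φ f'.φ H.sHat (fun x => (H.sHat x)⁻¹) (g * h) g h)⁻¹ *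
        (H.piHat g h)⁻¹) := by
  have hb : ∀ x, invS (stdBasis G) (f'.comp A.proj) H.s (FreeGroup.of x) = (H.sHat x)⁻¹ :=
    invS_basis (stdBasis G) (f'.comp A.proj) H.s
  refine hasUniqueForm_of_components _ hb (fun e => ?_) (fun g h => ?_)
  · change invT (stdBasis G) (f.comp A.proj) (f'.comp A.proj) H.s H.t (A.genE e) = _
    have h1 : omega (stdBasis G) (f.comp A.proj) H.s (invS (stdBasis G) (f'.comp A.proj) H.s)
        (A.Q1.bdE (A.genE e)) = 1 := omega_basis (stdBasis G) (A.bdE e)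
    rw [invT, h1, inv_one, one_mul]
    rfl
  · change invT (stdBasis G) (f.comp A.proj) (f'.comp A.proj) H.s H.t (A.genPair g h) = _
    -- Here the action of `s = δ(Π⁻¹)` is conjugation by `Π⁻¹`, which fixes `Π⁻¹`.
    rw [invT, omega_genPair H (invS_isDerivation _ _ _), s_bdE_genPair, sec_bdL]
    simp only [hb]
    change _ * ((H.piHat g h)⁻¹ * (H.piHat g h)⁻¹ * ((H.piHat g h)⁻¹)⁻¹) = _
    rw [mul_inv_cancel_right]

end LaxUnique

end TwoCrossedModule

theorem mainTheorem8 {L E G L' E' G' : Type*} [Group L] [Group E] [Group G] [Group L'] [Group E']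
    [Group G'] (A : TwoCrossedModule L E G) (A' : TwoCrossedModule L' E' G') :
    (∀ (f f' f'' : TwoCrossedModule.Hom A A') (H : TwoCrossedModule.LaxHomotopy f f') (H' : TwoCrossedModule.LaxHomotopy f' f''),
      ∃ K : TwoCrossedModule.LaxHomotopy f f'', TwoCrossedModule.IsConcat (TwoCrossedModule.stdBasis G) H H' K ∧
        TwoCrossedModule.HasUniqueForm K
          (fun g => H.sHat g * H'.sHat g)
          (fun e => A'.sec (H'.sHat (A.bdE e))⁻¹ (H.tHat e) * H'.tHat e)
          (fun g h => TwoCrossedModule.theta A' f.φ f'.φ H.sHat H'.sHat (g * h) g h *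
            H'.piHat g h * H.piHat g h)) ∧
    (∀ (f f' : TwoCrossedModule.Hom A A') (H : TwoCrossedModule.LaxHomotopy f f'),
      ∃ K : TwoCrossedModule.LaxHomotopy f' f, TwoCrossedModule.IsBar (TwoCrossedModule.stdBasis G) H K ∧ TwoCrossedModule.IsInverse (TwoCrossedModule.stdBasis G) H K ∧
        TwoCrossedModule.HasUniqueForm K
          (fun g => (H.sHat g)⁻¹)
          (fun e => A'.sec (H.sHat (A.bdE e)) (H.tHat e)⁻¹)
          (fun g h => (TwoCrossedModule.theta A' f.φ f'.φ H.sHat (fun x => (H.sHat x)⁻¹) (g * h) g h)⁻¹ *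
            (H.piHat g h)⁻¹)) := by
  refine ⟨fun f f' f'' H H' => ?_, fun f f' H => ?_⟩
  · exact ⟨H.concat (TwoCrossedModule.stdBasis G) H', ⟨rfl, rfl⟩,
      TwoCrossedModule.concat_hasUniqueForm H H'⟩
  · exact ⟨H.bar (TwoCrossedModule.stdBasis G), ⟨rfl, rfl⟩,
      H.isInverse_bar (TwoCrossedModule.stdBasis G), TwoCrossedModule.bar_hasUniqueForm H⟩
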